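/- Let $\hbar>0$ and let $(M,\Omega)$ be a symplectic manifold of dimension $2n$ (smooth, Hausdorff, $\sigma$-compact; in particular any connected paracompact one). For $f\in C^\infty(M,\mathbb R)$ let $X_f$ be the Hamiltonian vector field, defined by $\Omega(X_f,\cdot)=df$, and let $\{f,g\}=\Omega(X_f,X_g)$ be the Poisson bracket. Let $L\to M$ be a prequantum line bundle: a smooth complex line bundle with a smooth hermitian metric $h$ (linear in the first and conjugate linear in the second argument) and a smooth connection $\nabla$ compatible with $h$, i.e. $X(h(s,t))=h(\nabla_Xs,t)+h(s,\nabla_Xt)$, whose curvature form is $\Omega/(2\pi\hbar)$; here the curvature form is the $2$-form equal to $d\alpha$ on every open set carrying a nowhere vanishing smooth section $s$ with $\nabla s=2\pi i\,\alpha\otimes s$. On the complex vector space $\Gamma_c(L)$ of compactly supported smooth sections put $$\langle\psi_1|\psi_2\rangle=\Bigl(\frac1{2\pi\hbar}\Bigr)^n\int_M h(\psi_1,\psi_2)\,\Lambda_\Omega,\qquad \Lambda_\Omega=(-1)^{n(n-1)/2}\frac{1}{n!}\,\Omega^n,$$ where $M$ is oriented by $\Lambda_\Omega$ (integration against the Liouville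 measure); and for $f\in C^\infty(M,\mathbb R)$ let $O_f=-i\hbar\nabla_{X_f}+f$, a $\mathbb C$-linear operator on $\Gamma_c(L)$. Then the functions $h(\psi_1,\psi_2)$ are integrable, the map $f\mapsto O_f$ is $\mathbb R$-linear, every $O_f$ is symmetric, i.e. $\langle O_f\psi|\varphi\rangle=\langle\psi|O_f\varphi\rangle$ for all $\psi,\varphi\in\Gamma_c(L)$, and for all $f,g\in C^\infty(M,\mathbb R)$ $$O_1=\mathrm{Id},\qquad [O_f,O_g]=i\hbar\,O_{\{f,g\}}.$$ -/

import Mathlib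

open scoped Manifold ContDiff Bundle

noncomputable section

lemma isInvertible_of_nondegenerate {E : Type*} [NormedAddCommGroup E] [NormedSpace ℝ E]
    [FiniteDimensional ℝ E] (A : E →L[ℝ] E →L[ℝ] ℝ) (hA : ∀ v, (∀ w, A v w = 0) → v = 0) :
    A.IsInvertible := by
  have hinj : Function.Injective (A : E →ₗ[ℝ] E →L[ℝ] ℝ) := by
    rw [← LinearMap.ker_eq_bot, LinearMap.ker_eq_bot']
    intro v hv
    refine hA v fun w ↦ ?_
    have := congrArg (fun l : E →L[ℝ] ℝ ↦ l w) hv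
    simpa using this
  have hfr : Module.finrank ℝ E = Module.finrank ℝ (E →L[ℝ] ℝ) := by
    rw [← (LinearMap.toContinuousLinearMap (𝕜 := ℝ) (E := E) (F' := ℝ)).finrank_eq]
    exact (Subspace.dual_finrank_eq (K := ℝ) (V := E)).symm
  refine ⟨(LinearEquiv.ofInjectiveOfFinrankEq _ hinj hfr).toContinuousLinearEquiv, ?_⟩
  ext v
  rfl

lemma contMDiff_inverse_apply {E H M : Type*} [NormedAddCommGroup E] [NormedSpace ℝ E]
    [CompleteSpace E] [TopologicalSpace H] {I : ModelWithCorners ℝ E H}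
    [TopologicalSpace M] [ChartedSpace H M] [IsManifold I ∞ M]
    {A : ∀ x : M, TangentSpace I x →L[ℝ] TangentSpace I x →L[ℝ] ℝ}
    {u : ∀ x : M, TangentSpace I x →L[ℝ] ℝ}
    (hA : ContMDiff I (I.prod 𝓘(ℝ, E →L[ℝ] E →L[ℝ] ℝ)) ∞
      (fun x ↦ Bundle.TotalSpace.mk' (E →L[ℝ] E →L[ℝ] ℝ)
        (E := fun x : M ↦ TangentSpace I x →L[ℝ] TangentSpace I x →L[ℝ] ℝ) x (A x)))
    (hu : ContMDiff I (I.prod 𝓘(ℝ, E →L[ℝ] ℝ)) ∞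
      (fun x ↦ Bundle.TotalSpace.mk' (E →L[ℝ] ℝ)
        (E := fun x : M ↦ TangentSpace I x →L[ℝ] ℝ) x (u x)))
    (hinv : ∀ x, (A x).IsInvertible) :
    ContMDiff I (I.prod 𝓘(ℝ, E)) ∞ (fun x ↦ Bundle.TotalSpace.mk' E
      (E := (TangentSpace I : M → Type _)) x ((A x).inverse (u x))) := by
  intro x₀
  have hA := (contMDiffAt_hom_bundle _).1 (hA x₀)
  refine ContMDiffAt.clm_apply_of_inCoordinates (F₁ := E →L[ℝ] ℝ) (F₂ := E)
    (E₁ := fun x : M ↦ TangentSpace I x →L[ℝ] ℝ) (E₂ := (TangentSpace I : M → Type _))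
    (b₁ := id) (b₂ := id) (v := u)
    (ϕ := fun x ↦ (A x).inverse) ?_ (hu x₀) contMDiffAt_id
  have hx₀ : x₀ ∈ (trivializationAt E (TangentSpace I : M → Type _) x₀).baseSet :=
    FiberBundle.mem_baseSet_trivializationAt' x₀
  have hx₀' : x₀ ∈ (trivializationAt (E →L[ℝ] ℝ)
    (fun x : M ↦ TangentSpace I x →L[ℝ] ℝ) x₀).baseSet :=
    FiberBundle.mem_baseSet_trivializationAt' x₀
  have h : ContMDiffAt I 𝓘(ℝ, (E →L[ℝ] ℝ) →L[ℝ] E) ∞ (ContinuousLinearMap.inverse ∘ fun x ↦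
      ContinuousLinearMap.inCoordinates E (TangentSpace I : M → Type _) (E →L[ℝ] ℝ)
        (fun x : M ↦ TangentSpace I x →L[ℝ] ℝ) x₀ x x₀ x (A x)) x₀ := by
    refine ContMDiffAt.comp x₀ (ContDiffAt.contMDiffAt ?_) hA.2
    apply ContinuousLinearMap.IsInvertible.contDiffAt_map_inverse
    rw [ContinuousLinearMap.inCoordinates_eq hx₀ hx₀']
    exact ContinuousLinearMap.isInvertible_equiv.comp
      ((hinv x₀).comp ContinuousLinearMap.isInvertible_equiv)
  refine h.congr_of_eventuallyEq ?_
  filter_upwards [(trivializationAt _ _ _).open_baseSet.mem_nhds hx₀,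
    (trivializationAt _ _ _).open_baseSet.mem_nhds hx₀'] with x hx hx'
  simp only [Function.comp_apply, id]
  rw [ContinuousLinearMap.inCoordinates_eq hx hx', ContinuousLinearMap.inCoordinates_eq hx' hx]
  simp only [ContinuousLinearMap.inverse_equiv_comp, ContinuousLinearMap.inverse_comp_equiv,
    ContinuousLinearEquiv.symm_symm]
  rfl

/-- The differential of a smooth function is a smooth section of the cotangent bundle. -/
lemma contMDiff_mvfderiv {E H M : Type*} [NormedAddCommGroup E] [NormedSpace ℝ E]
    [TopologicalSpace H] {I : ModelWithCorners ℝ E H}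
    [TopologicalSpace M] [ChartedSpace H M] [IsManifold I ∞ M] (f : C^∞⟮I, M; ℝ⟯) :
    ContMDiff I (I.prod 𝓘(ℝ, E →L[ℝ] ℝ)) ∞
      (fun x ↦ Bundle.TotalSpace.mk' (E →L[ℝ] ℝ)
        (E := fun x : M ↦ TangentSpace I x →L[ℝ] ℝ) x (mvfderiv I f x)) := by
  intro x₀
  refine (contMDiffAt_hom_bundle (E₂ := Bundle.Trivial M ℝ) _).2 ⟨contMDiffAt_id, ?_⟩
  have h := (f.contMDiff x₀).mfderiv_const (m := ∞) le_rfl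
  refine h.congr_of_eventuallyEq (Filter.Eventually.of_forall fun x ↦ ?_)
  ext v
  simp [inTangentCoordinates, ContinuousLinearMap.inCoordinates, mvfderiv]
  rfl

section Geometry

variable {n : ℕ} {M : Type*} [TopologicalSpace M]
  [ChartedSpace (EuclideanSpace ℝ (Fin (2 * n))) M] [IsManifold (𝓡 (2 * n)) ∞ M]

variable (n M) in
/-- Smooth real vector fields on the `2n`-dimensional manifold `M`. -/
abbrev SmoothVectorField : Type _ :=
  Cₛ^∞⟮𝓡 (2 * n); EuclideanSpace ℝ (Fin (2 * n)), (TangentSpace (𝓡 (2 * n)) : M → Type _)⟯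

/-- The exterior derivative of a complex-valued `1`-form `α`, evaluated on two vector fields:
`dα(X, Y) = X(α(Y)) - Y(α(X)) - α([X, Y])`. -/
def extDerivOneForm (α : ∀ x : M, TangentSpace (𝓡 (2 * n)) x →L[ℝ] ℂ)
    (X Y : SmoothVectorField n M) (x : M) : ℂ :=
  mvfderiv (𝓡 (2 * n)) (fun y ↦ α y (Y y)) x (X x)
    - mvfderiv (𝓡 (2 * n)) (fun y ↦ α y (X y)) x (Y x)
    - α x (VectorField.mlieBracket (𝓡 (2 * n)) X Y x)

/-- The exterior derivative of a real `2`-form `α`, evaluated on three vector fields: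
`dα(X, Y, Z)` is the cyclic sum of `X(α(Y, Z)) - α([X, Y], Z)`. -/
def extDerivTwoForm
    (α : ∀ x : M, TangentSpace (𝓡 (2 * n)) x →L[ℝ] TangentSpace (𝓡 (2 * n)) x →L[ℝ] ℝ)
    (X Y Z : SmoothVectorField n M) (x : M) : ℝ :=
  mvfderiv (𝓡 (2 * n)) (fun y ↦ α y (Y y) (Z y)) x (X x)
    + mvfderiv (𝓡 (2 * n)) (fun y ↦ α y (Z y) (X y)) x (Y x)
    + mvfderiv (𝓡 (2 * n)) (fun y ↦ α y (X y) (Y y)) x (Z x)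
    - α x (VectorField.mlieBracket (𝓡 (2 * n)) X Y x) (Z x)
    - α x (VectorField.mlieBracket (𝓡 (2 * n)) Y Z x) (X x)
    - α x (VectorField.mlieBracket (𝓡 (2 * n)) Z X x) (Y x)

variable (n M) in
/-- A symplectic form: a smooth, closed, nondegenerate `2`-form. -/
structure SymplecticForm where
  toFun : ∀ x : M, TangentSpace (𝓡 (2 * n)) x →L[ℝ] TangentSpace (𝓡 (2 * n)) x →L[ℝ] ℝ
  contMDiff_toFun :
    ContMDiff (𝓡 (2 * n))
      ((𝓡 (2 * n)).prod
        𝓘(ℝ, EuclideanSpace ℝ (Fin (2 * n)) →L[ℝ] EuclideanSpace ℝ (Fin (2 * n)) →L[ℝ] ℝ)) ∞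
      (fun x ↦ Bundle.TotalSpace.mk'
        (EuclideanSpace ℝ (Fin (2 * n)) →L[ℝ] EuclideanSpace ℝ (Fin (2 * n)) →L[ℝ] ℝ)
        (E := fun x : M ↦
          TangentSpace (𝓡 (2 * n)) x →L[ℝ] TangentSpace (𝓡 (2 * n)) x →L[ℝ] ℝ) x (toFun x))
  alternating : ∀ (x : M) (v : TangentSpace (𝓡 (2 * n)) x), toFun x v v = 0
  nondegenerate : ∀ (x : M) (v : TangentSpace (𝓡 (2 * n)) x),
    (∀ w : TangentSpace (𝓡 (2 * n)) x, toFun x v w = 0) → v = 0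
  closed : ∀ (X Y Z : SmoothVectorField n M) (x : M), extDerivTwoForm toFun X Y Z x = 0

namespace SymplecticForm

variable (Ω : SymplecticForm n M)

lemma isInvertible_toFun (x : M) : (Ω.toFun x).IsInvertible :=
  isInvertible_of_nondegenerate (E := EuclideanSpace ℝ (Fin (2 * n))) (Ω.toFun x)
    (Ω.nondegenerate x)

/-- The Hamiltonian vector field of `f` as a map, `X_f(x) = (v ↦ Ω(v, ·))⁻¹ (df(x))`. -/
def hamiltonianField (f : M → ℝ) (x : M) : TangentSpace (𝓡 (2 * n)) x :=
  (Ω.toFun x).inverse (mvfderiv (𝓡 (2 * n)) f x)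

/-- The defining property `i(X_f) Ω = df`. -/
lemma toFun_hamiltonianField (f : M → ℝ) (x : M) :
    Ω.toFun x (Ω.hamiltonianField f x) = mvfderiv (𝓡 (2 * n)) f x := by
  obtain ⟨e, he⟩ := Ω.isInvertible_toFun x
  rw [hamiltonianField, ← he, ContinuousLinearMap.inverse_equiv]
  simp

lemma contMDiff_hamiltonianField (f : C^∞⟮𝓡 (2 * n), M; ℝ⟯) :
    ContMDiff (𝓡 (2 * n)) ((𝓡 (2 * n)).prod 𝓘(ℝ, EuclideanSpace ℝ (Fin (2 * n)))) ∞
      (fun x ↦ Bundle.TotalSpace.mk' (EuclideanSpace ℝ (Fin (2 * n)))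
        (E := (TangentSpace (𝓡 (2 * n)) : M → Type _)) x (Ω.hamiltonianField f x)) :=
  contMDiff_inverse_apply Ω.contMDiff_toFun (contMDiff_mvfderiv f) Ω.isInvertible_toFun

/-- The Hamiltonian vector field `X_f` of a smooth function, determined by `Ω(X_f, ·) = df`. -/
def hamiltonianVectorField (f : C^∞⟮𝓡 (2 * n), M; ℝ⟯) : SmoothVectorField n M :=
  ⟨Ω.hamiltonianField f, Ω.contMDiff_hamiltonianField f⟩

/-- The Poisson bracket `{f, g} = Ω(X_f, X_g)`. -/
def poissonBracket (f g : C^∞⟮𝓡 (2 * n), M; ℝ⟯) : C^∞⟮𝓡 (2 * n), M; ℝ⟯ :=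
  ⟨fun x ↦ Ω.toFun x (Ω.hamiltonianVectorField f x) (Ω.hamiltonianVectorField g x), by
    have h := ContMDiff.clm_bundle_apply (E₂ := Bundle.Trivial M ℝ) (contMDiff_mvfderiv f)
      (Ω.hamiltonianVectorField g).contMDiff
    intro x
    refine ((Bundle.contMDiffAt_section (E := Bundle.Trivial M ℝ) x).1 (h x)).congr_of_eventuallyEq
      (Filter.Eventually.of_forall fun y ↦ ?_)
    exact congrArg (fun l : TangentSpace (𝓡 (2 * n)) y →L[ℝ] ℝ ↦ l (Ω.hamiltonianVectorField g y))
      (Ω.toFun_hamiltonianField f y)⟩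

/-- The value of the `2n`-form `Ω ∧ ⋯ ∧ Ω` (`n` factors) at `x` on `v₀, …, v_{2n-1}`, that is
`2⁻ⁿ ∑_σ sgn(σ) ∏_{j < n} Ω(v_{σ(2j)}, v_{σ(2j+1)})`. -/
def topPower (x : M) (v : Fin (2 * n) → TangentSpace (𝓡 (2 * n)) x) : ℝ :=
  (1 / 2 ^ n : ℝ) * ∑ σ : Equiv.Perm (Fin (2 * n)), ((Equiv.Perm.sign σ : ℤ) : ℝ) *
    ∏ j : Fin n, Ω.toFun x (v (σ ⟨2 * j.1, by omega⟩)) (v (σ ⟨2 * j.1 + 1, by omega⟩))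

/-- The Liouville volume form `(-1)^{n(n-1)/2} Ωⁿ / n!`. -/
def liouvilleForm (x : M) (v : Fin (2 * n) → TangentSpace (𝓡 (2 * n)) x) : ℝ :=
  (-1 : ℝ) ^ (n * (n - 1) / 2) * (1 / (n.factorial : ℝ)) * Ω.topPower x v

/-- The density `|Λ(∂₁, …, ∂₂ₙ)|` of the Liouville form in the coordinates of the chart at `p`, as
a function on the coordinate space; `∂ᵢ` are the coordinate vector fields of the chart. -/
def chartDensity (p : M) (z : EuclideanSpace ℝ (Fin (2 * n))) : ℝ :=
  |Ω.liouvilleForm ((chartAt (EuclideanSpace ℝ (Fin (2 * n))) p).symm z) (fun i ↦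
    mfderiv 𝓘(ℝ, EuclideanSpace ℝ (Fin (2 * n))) (𝓡 (2 * n))
      (chartAt (EuclideanSpace ℝ (Fin (2 * n))) p).symm z (EuclideanSpace.single i (1 : ℝ)))|

/-- The Liouville measure of the domain of the chart at `p`: `|Λ(∂₁, …, ∂₂ₙ)| dz₁ ⋯ dz₂ₙ` on the
image of the chart, transported to `M`. -/
def chartMeasure [MeasurableSpace M] (p : M) : MeasureTheory.Measure M :=
  ((MeasureTheory.volume.restrict
      (chartAt (EuclideanSpace ℝ (Fin (2 * n))) p).target).withDensity
    (fun z ↦ ENNReal.ofReal (Ω.chartDensity p z))).map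
      (chartAt (EuclideanSpace ℝ (Fin (2 * n))) p).symm

/-- The Liouville measure of `M`, i.e. integration of functions against the volume form `Λ` with
respect to the orientation in which `Λ` is positive. The measures of the chart domains agree on
overlaps, and their least upper bound is the measure which restricts to each of them. -/
def liouvilleMeasure [MeasurableSpace M] : MeasureTheory.Measure M :=
  ⨆ p : M, Ω.chartMeasure p

end SymplecticForm

end Geometry

/-! Complex line bundles over `M`: `L` is a smooth (real) vector bundle with model fibre `ℂ` and
complex vector spaces as fibres, whose local trivializations are complex linear. -/

section LineBundle

variable {n : ℕ} {M : Type*} [TopologicalSpace M]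
  [ChartedSpace (EuclideanSpace ℝ (Fin (2 * n))) M] [IsManifold (𝓡 (2 * n)) ∞ M]
  {L : M → Type*} [TopologicalSpace (Bundle.TotalSpace ℂ L)]
  [∀ x, AddCommGroup (L x)] [∀ x, Module ℂ (L x)] [∀ x, TopologicalSpace (L x)]
  [∀ x, IsTopologicalAddGroup (L x)] [∀ x, ContinuousSMul ℝ (L x)]
  [FiberBundle ℂ L] [VectorBundle ℂ ℂ L] [VectorBundle ℝ ℂ L]
  [ContMDiffVectorBundle ∞ ℂ L (𝓡 (2 * n))]

variable (n) in
/-- A section of `L` is smooth. -/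
def IsSmoothSection (s : ∀ x, L x) : Prop :=
  ContMDiff (𝓡 (2 * n)) ((𝓡 (2 * n)).prod 𝓘(ℝ, ℂ)) ∞
    (fun x ↦ Bundle.TotalSpace.mk' ℂ x (s x))

variable (n L) in
/-- A hermitian structure on `L`: hermitian inner products on the fibres, linear in the first and
conjugate linear in the second argument, depending smoothly on the point. -/
structure HermitianStructure where
  form : ∀ x, L x →ₗ[ℂ] L x →ₗ⋆[ℂ] ℂ
  conj_symm : ∀ (x : M) (v w : L x), form x v w = starRingEnd ℂ (form x w v)
  pos : ∀ (x : M) (v : L x), v ≠ 0 → 0 < (form x v v).re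
  smooth : ∀ s t : ∀ x, L x, IsSmoothSection n s → IsSmoothSection n t →
    ContMDiff (𝓡 (2 * n)) 𝓘(ℝ, ℂ) ∞ (fun x ↦ form x (s x) (t x))

/-- `K` is the curvature form of the connection `∇` on `L`: whenever `s` is a nowhere vanishing
smooth section on an open set `U` and `∇ s = 2πi α ⊗ s` on `U`, we have `K = dα` on `U`. -/
def IsCurvatureForm (conn : CovariantDerivative (𝓡 (2 * n)) ℂ L)
    (K : ∀ x : M, TangentSpace (𝓡 (2 * n)) x → TangentSpace (𝓡 (2 * n)) x → ℂ) : Prop :=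
  ∀ (U : Set M) (s : ∀ x, L x) (α : ∀ x : M, TangentSpace (𝓡 (2 * n)) x →L[ℝ] ℂ), IsOpen U →
    ContMDiffOn (𝓡 (2 * n)) ((𝓡 (2 * n)).prod 𝓘(ℝ, ℂ)) ∞
      (fun x ↦ Bundle.TotalSpace.mk' ℂ x (s x)) U →
    (∀ x ∈ U, s x ≠ 0) →
    (∀ x ∈ U, ∀ v : TangentSpace (𝓡 (2 * n)) x,
      conn s x v = (2 * Real.pi * Complex.I * α x v) • s x) →
    ∀ (X Y : SmoothVectorField n M), ∀ x ∈ U, K x (X x) (Y x) = extDerivOneForm α X Y x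

variable (L) in
/-- The data of a prequantum line bundle of `(M, Ω)` on the complex line bundle `L`: a hermitian
structure `h` and a smooth complex connection `∇` (with `conn s x v` standing for `∇_v s`) which is
compatible with `h` and has curvature form `Ω / (2πħ)`. -/
structure PrequantumStructure (ħ : ℝ) (Ω : SymplecticForm n M) where
  herm : HermitianStructure n L
  conn : CovariantDerivative (𝓡 (2 * n)) ℂ L
  conn_smooth : CovariantDerivative.ContMDiffCovariantDerivative conn ∞
  conn_complex : ∀ (c : ℂ) (s : ∀ x, L x) (x : M) (v : TangentSpace (𝓡 (2 * n)) x),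
    MDifferentiableAt (𝓡 (2 * n)) ((𝓡 (2 * n)).prod 𝓘(ℝ, ℂ))
      (fun y ↦ Bundle.TotalSpace.mk' ℂ y (s y)) x →
    conn (c • s) x v = c • conn s x v
  compatible : ∀ s t : ∀ x, L x, IsSmoothSection n s → IsSmoothSection n t →
    ∀ (x : M) (v : TangentSpace (𝓡 (2 * n)) x),
      mvfderiv (𝓡 (2 * n)) (fun y ↦ herm.form y (s y) (t y)) x v =
        herm.form x (conn s x v) (t x) + herm.form x (s x) (conn t x v)
  curvature : IsCurvatureForm conn
    (fun x v w ↦ ((Ω.toFun x v w / (2 * Real.pi * ħ) : ℝ) : ℂ))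

lemma isSmoothSection_smul (c : ℂ) {s : ∀ x, L x} (hs : IsSmoothSection n s) :
    IsSmoothSection n (c • s) := by
  intro x
  have h := (Bundle.contMDiffAt_section x).1 (hs x)
  have h' : ContMDiffAt (𝓡 (2 * n)) 𝓘(ℝ, ℂ) ∞
      (fun y ↦ c * (trivializationAt ℂ L x ⟨y, s y⟩).2) x :=
    (ContinuousLinearMap.mul ℝ ℂ c).contMDiff.contMDiffAt.comp x h
  refine (Bundle.contMDiffAt_section x).2 (h'.congr_of_eventuallyEq ?_)
  filter_upwards [(trivializationAt ℂ L x).open_baseSet.mem_nhds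
    (FiberBundle.mem_baseSet_trivializationAt' x)] with y hy
  exact ((trivializationAt ℂ L x).linear ℂ hy).2 c (s y)

variable (n L) in
/-- The complex vector space of smooth sections of `L` with compact support. -/
def compactSections : Submodule ℂ (∀ x, L x) where
  carrier := {s | IsSmoothSection n s ∧ IsCompact (closure {x | s x ≠ 0})}
  add_mem' := by
    rintro s t ⟨hs, hs'⟩ ⟨ht, ht'⟩
    refine ⟨ContMDiff.add_section hs ht, (hs'.union ht').of_isClosed_subset isClosed_closure ?_⟩
    rw [← closure_union]
    refine closure_mono fun x hx ↦ ?_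
    by_contra h
    simp only [Set.mem_union, Set.mem_ofPred_eq, not_or, not_not] at h
    exact hx (by simp [h.1, h.2])
  zero_mem' := by
    refine ⟨Bundle.contMDiff_zeroSection ℝ L, ?_⟩
    simp
  smul_mem' := by
    rintro c s ⟨hs, hs'⟩
    refine ⟨isSmoothSection_smul c hs, hs'.of_isClosed_subset isClosed_closure ?_⟩
    refine closure_mono fun x hx h ↦ hx ?_
    simp [h]

namespace PrequantumStructure

variable {ħ : ℝ} {Ω : SymplecticForm n M} (P : PrequantumStructure L ħ Ω)

lemma operator_mem (f : C^∞⟮𝓡 (2 * n), M; ℝ⟯) (ψ : compactSections n L) :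
    (fun x ↦ (-(Complex.I * ħ)) • P.conn ψ.1 x (Ω.hamiltonianVectorField f x)
      + (f x : ℂ) • ψ.1 x) ∈ compactSections n L := by
  obtain ⟨hψ, hψ'⟩ := ψ.2
  constructor
  · have h₁ : IsSmoothSection n (fun x ↦ P.conn ψ.1 x (Ω.hamiltonianVectorField f x)) := by
      have h := P.conn_smooth.contMDiff.contMDiff (σ := ψ.1) (hψ.contMDiffOn.of_le le_rfl)
      rw [contMDiffOn_univ] at h
      exact ContMDiff.clm_bundle_apply h (Ω.hamiltonianVectorField f).contMDiff
    have h₂ : IsSmoothSection n (fun x ↦ (f x : ℂ) • ψ.1 x) :=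
      ContMDiff.smul_section f.contMDiff hψ
    exact ContMDiff.add_section (isSmoothSection_smul (-(Complex.I * ħ)) h₁) h₂
  · refine hψ'.of_isClosed_subset isClosed_closure (closure_minimal ?_ isClosed_closure)
    intro x hx
    by_contra hxs
    have hev : ∀ᶠ y in nhds x, ψ.1 y = (0 : ∀ x, L x) y := by
      filter_upwards [isClosed_closure.isOpen_compl.mem_nhds hxs] with y hy
      by_contra h
      exact hy (subset_closure h)
    have h0 : P.conn ψ.1 x = 0 := by
      have h := (P.conn.isCovariantDerivativeOn (s := Set.univ)).congr_of_eventuallyEq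
        ((hψ x).mdifferentiableAt (by simp)) (Bundle.mdifferentiableAt_zeroSection ..)
        Filter.univ_mem hev
      exact h.trans (congrFun P.conn.zero x)
    have h1 : ψ.1 x = 0 := hev.self_of_nhds
    exact hx (by simp [h0, h1])

/-- The prequantization operator `O_f = -iħ ∇_{X_f} + f`, acting on compactly supported smooth
sections. -/
def operator (f : C^∞⟮𝓡 (2 * n), M; ℝ⟯) : Module.End ℂ (compactSections n L) where
  toFun ψ := ⟨fun x ↦ (-(Complex.I * ħ)) • P.conn ψ.1 x (Ω.hamiltonianVectorField f x)
      + (f x : ℂ) • ψ.1 x, P.operator_mem f ψ⟩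
  map_add' := by
    intro ψ φ
    ext x
    have h : P.conn (ψ.1 + φ.1) x = P.conn ψ.1 x + P.conn φ.1 x :=
      P.conn.isCovariantDerivativeOnUniv.add ((ψ.2.1 x).mdifferentiableAt (by simp))
        ((φ.2.1 x).mdifferentiableAt (by simp))
    simp only [Submodule.coe_add, Pi.add_apply, h, add_apply, smul_add]
    abel
  map_smul' := by
    intro c ψ
    ext x
    have h := P.conn_complex c ψ.1 x (Ω.hamiltonianVectorField f x)
      ((ψ.2.1 x).mdifferentiableAt (by simp))
    simp only [Submodule.coe_smul, Pi.smul_apply, h, RingHom.id_apply, smul_add]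
    rw [smul_comm c, smul_comm c]

/-- The function `h(ψ₁, ψ₂)` on `M`. -/
def pairing (ψ₁ ψ₂ : compactSections n L) (x : M) : ℂ :=
  P.herm.form x (ψ₁.1 x) (ψ₂.1 x)

/-- The inner product `⟨ψ₁ | ψ₂⟩ = (1 / 2πħ)ⁿ ∫ h(ψ₁, ψ₂) Λ`. -/
def innerProduct [MeasurableSpace M] (ψ₁ ψ₂ : compactSections n L) : ℂ :=
  (((1 / (2 * Real.pi * ħ)) ^ n : ℝ) : ℂ) * ∫ x, P.pairing ψ₁ ψ₂ x ∂Ω.liouvilleMeasure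

end PrequantumStructure

end LineBundle

end

/-! ### Linear algebra of the top power of a bilinear form. -/

noncomputable section

section TopPower

set_option synthInstance.maxHeartbeats 200000

variable {E : Type*} [NormedAddCommGroup E] [NormedSpace ℝ E] {n : ℕ}

/-! The commutation relation is local and algebraic. Closedness of `Ω`, evaluated on `X_f`, `X_g`
and a third field, together with nondegeneracy gives `[X_f, X_g] = -X_{f,g}`
(`mlieBracket_hamiltonianVectorField`). In a local frame `s` with `∇s = 2πi α ⊗ s`, the commutator
of covariant derivatives minus `∇_{[X,Y]}` is multiplication by `2πi dα(X, Y)`, which is `(i/ħ) Ω(X,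
Y)` by the curvature condition (`conn_commutator`). Expanding `[O_f, O_g]`, the curvature term
contributes `-iħ{f,g}` and the derivatives of `f` and `g` contribute `2iħ{f,g}`. What remains is
exactly the zeroth order term of `iħ O_{f,g}`.

Symmetry is a statement about integrals. Compatibility of `∇` with `h` shows that `h(O_f ψ, φ) -
h(ψ, O_f φ) = -iħ X_f(h(ψ, φ))` (`pairing_operator`), so it suffices that `∫ X_f(u) = 0` for every
smooth compactly supported `u`: Hamiltonian flows preserve Liouville measure
(`integral_mvfderiv_hamiltonian`). A partition of unity reduces this to one chart. There the Lie
derivative of the coordinate form along `X_f` vanishes, hence its top power `P` satisfies `dP(X) =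
-tr(DX) P`, that is `div(P X) = 0`, and the divergence theorem applies. The measure has density
`|P|` rather than `P`; replacing `|P|` by `√(P² + ε²)` and letting `ε → 0` deals with the absolute
value without any information on the sign or the zeros of `P`.

The Liouville measure is a supremum of measures carried by the charts. These agree on overlaps by
the change of variables formula, so over a Lindelöf space the supremum restricts to each of them
(`iSup_measure_restrict_eq`). This gives the coordinate formula for integrals and local finiteness,
hence integrability of the pairings. -/

lemma prod_pairs_update (A : E →L[ℝ] E →L[ℝ] ℝ) (v : Fin (2 * n) → E) (i : Fin (2 * n)) :
    ∃ l : E →ₗ[ℝ] ℝ, ∀ z, ∏ j : Fin n, A (Function.update v i z ⟨2 * j.1, by omega⟩)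
      (Function.update v i z ⟨2 * j.1 + 1, by omega⟩) = l z := by
  have hj : i.1 / 2 < n := by omega
  set c := ∏ j ∈ Finset.univ.erase (⟨i.1 / 2, hj⟩ : Fin n),
    A (v ⟨2 * j.1, by omega⟩) (v ⟨2 * j.1 + 1, by omega⟩) with hc
  have key : ∀ z, ∏ j : Fin n, A (Function.update v i z ⟨2 * j.1, by omega⟩)
      (Function.update v i z ⟨2 * j.1 + 1, by omega⟩) =
      A (Function.update v i z ⟨2 * (i.1 / 2), by omega⟩)
        (Function.update v i z ⟨2 * (i.1 / 2) + 1, by omega⟩) * c := by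
    intro z
    rw [← Finset.mul_prod_erase _ _ (Finset.mem_univ (⟨i.1 / 2, hj⟩ : Fin n))]
    congr 1
    refine Finset.prod_congr rfl fun j hj' ↦ ?_
    have hne : j.1 ≠ i.1 / 2 := fun h ↦ (Finset.mem_erase.1 hj').1 (Fin.ext h)
    rw [Function.update_of_ne fun h ↦ hne (by have := congrArg Fin.val h; simp at this; omega),
      Function.update_of_ne fun h ↦ hne (by have := congrArg Fin.val h; simp at this; omega)]
  simp only [key]
  -- The index `i` occurs only in the pair `i / 2`; its parity decides which of the two slots of `A`
  -- it fills.
  rcases Nat.even_or_odd' i.1 with ⟨k, hk | hk⟩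
  · have h1 : (⟨2 * (i.1 / 2), by omega⟩ : Fin (2 * n)) = i := Fin.ext (by simp; omega)
    have h2 : (⟨2 * (i.1 / 2) + 1, by omega⟩ : Fin (2 * n)) ≠ i := fun h ↦ by
      have := congrArg Fin.val h; simp at this; omega
    refine ⟨c • (A.flip (v ⟨2 * (i.1 / 2) + 1, by omega⟩) : E →ₗ[ℝ] ℝ), fun z ↦ ?_⟩
    simp [h1, Function.update_of_ne h2, mul_comm]
  · have h1 : (⟨2 * (i.1 / 2) + 1, by omega⟩ : Fin (2 * n)) = i := Fin.ext (by simp; omega)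
    have h2 : (⟨2 * (i.1 / 2), by omega⟩ : Fin (2 * n)) ≠ i := fun h ↦ by
      have := congrArg Fin.val h; simp at this; omega
    refine ⟨c • (A (v ⟨2 * (i.1 / 2), by omega⟩) : E →ₗ[ℝ] ℝ), fun z ↦ ?_⟩
    simp [h1, Function.update_of_ne h2, mul_comm]

/-- The product `∏ j, A (v₂ⱼ, v₂ⱼ₊₁)` as a multilinear map in `v`. -/
def pairProduct (A : E →L[ℝ] E →L[ℝ] ℝ) : MultilinearMap ℝ (fun _ : Fin (2 * n) ↦ E) ℝ where
  toFun v := ∏ j : Fin n, A (v ⟨2 * j.1, by omega⟩) (v ⟨2 * j.1 + 1, by omega⟩)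
  map_update_add' := by
    -- The linearity fields quantify over all decidability instances on the index type, while
    -- `prod_pairs_update` uses the canonical one.
    intro inst v i x y
    obtain rfl : inst = instDecidableEqFin _ := Subsingleton.elim _ _
    obtain ⟨l, hl⟩ := prod_pairs_update A v i
    simp only [hl, map_add]
  map_update_smul' := by
    intro inst v i c x
    obtain rfl : inst = instDecidableEqFin _ := Subsingleton.elim _ _
    obtain ⟨l, hl⟩ := prod_pairs_update A v i
    simp only [hl, map_smul]

/-- The normalized top exterior power of a bilinear form on a space of dimension `2n`. -/
def volumeOfForm (A : E →L[ℝ] E →L[ℝ] ℝ) : E [⋀^Fin (2 * n)]→ₗ[ℝ] ℝ :=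
  ((-1 : ℝ) ^ (n * (n - 1) / 2) * (1 / (n.factorial : ℝ)) * (1 / 2 ^ n : ℝ)) •
    MultilinearMap.alternatization (pairProduct A)

lemma volumeOfForm_apply (A : E →L[ℝ] E →L[ℝ] ℝ) (v : Fin (2 * n) → E) :
    volumeOfForm A v = (-1 : ℝ) ^ (n * (n - 1) / 2) * (1 / (n.factorial : ℝ)) *
      ((1 / 2 ^ n : ℝ) * ∑ σ : Equiv.Perm (Fin (2 * n)), ((Equiv.Perm.sign σ : ℤ) : ℝ) *
        ∏ j : Fin n, A (v (σ ⟨2 * j.1, by omega⟩)) (v (σ ⟨2 * j.1 + 1, by omega⟩))) := by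
  rw [volumeOfForm, AlternatingMap.smul_apply, MultilinearMap.alternatization_apply,
    smul_eq_mul, mul_assoc _ (1 / 2 ^ n : ℝ)]
  congr 2
  refine Finset.sum_congr rfl fun σ _ ↦ ?_
  rw [Units.smul_def, zsmul_eq_mul]
  rfl

lemma volumeOfForm_bilinearComp (A : E →L[ℝ] E →L[ℝ] ℝ) {F : Type*} [NormedAddCommGroup F]
    [NormedSpace ℝ F] (B : F →L[ℝ] E) (v : Fin (2 * n) → F) :
    volumeOfForm (A.bilinearComp B B) v = volumeOfForm A (fun i ↦ B (v i)) := by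
  simp [volumeOfForm_apply]

/-- An alternating form of top degree is a multiple of the determinant in a basis, and the latter is
multiplied by `det B`. -/
lemma volumeOfForm_comp_eq_det_mul (A : E →L[ℝ] E →L[ℝ] ℝ) (b : Module.Basis (Fin (2 * n)) ℝ E)
    (B : E →L[ℝ] E) (v : Fin (2 * n) → E) :
    volumeOfForm A (fun i ↦ B (v i)) = B.det * volumeOfForm A v := by
  have h := (volumeOfForm (n := n) A).eq_smul_basis_det b
  rw [h]
  have := b.det_comp (B : E →ₗ[ℝ] E) v
  simp only [AlternatingMap.smul_apply, smul_eq_mul]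
  have e : (fun i ↦ B (v i)) = ⇑(B : E →ₗ[ℝ] E) ∘ v := rfl
  rw [e, this, ContinuousLinearMap.det]
  ring

lemma contDiff_volumeOfForm [FiniteDimensional ℝ E] {k : WithTop ℕ∞} (v : Fin (2 * n) → E) :
    ContDiff ℝ k (fun A : E →L[ℝ] E →L[ℝ] ℝ ↦ volumeOfForm A v) := by
  simp only [volumeOfForm_apply]
  refine contDiff_const.mul (contDiff_const.mul (ContDiff.sum fun σ _ ↦ contDiff_const.mul
    (contDiff_prod fun j _ ↦ ?_)))
  exact (contDiff_id.clm_apply contDiff_const).clm_apply contDiff_const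

lemma hasDerivAt_det_one_add_smul (b : Module.Basis (Fin (2 * n)) ℝ E) (C : E →L[ℝ] E) :
    HasDerivAt (fun t : ℝ ↦ (ContinuousLinearMap.id ℝ E + t • C).det)
      (LinearMap.trace ℝ E C) 0 := by
  obtain ⟨q, hq⟩ : ∃ q : Polynomial ℝ, ∀ t : ℝ, (ContinuousLinearMap.id ℝ E + t • C).det =
      1 + LinearMap.trace ℝ E C * t + q.eval t * t ^ 2 := by
    -- The polynomial `det(1 + X C)` has constant coefficient `1` and linear coefficient `tr C`;
    -- applying `divX` twice leaves the factor of `X²`.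
    refine ⟨(Matrix.det (1 + (Polynomial.X : Polynomial ℝ) •
      (LinearMap.toMatrix b b C).map Polynomial.C)).divX.divX, fun t ↦ ?_⟩
    rw [LinearMap.trace_eq_matrix_trace ℝ b, ← Matrix.det_one_add_smul, ContinuousLinearMap.det,
      ← LinearMap.det_toMatrix b]
    congr 1
    have : ((ContinuousLinearMap.id ℝ E + t • C : E →L[ℝ] E) : E →ₗ[ℝ] E) =
      LinearMap.id + t • (C : E →ₗ[ℝ] E) := rfl
    rw [this, map_add, map_smul, LinearMap.toMatrix_id]
  simp only [hq]
  have h1 : HasDerivAt (fun t : ℝ ↦ 1 + LinearMap.trace ℝ E C * t)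
      (LinearMap.trace ℝ E C * 1) 0 :=
    ((hasDerivAt_id (0 : ℝ)).const_mul _).const_add _
  have h2 := (q.hasDerivAt (0 : ℝ)).mul ((hasDerivAt_id (0 : ℝ)).pow 2)
  simpa using! h1.add h2

/-- The term `t² d` does not change the velocity of the curve at `t = 0`. It is allowed because
pulling a bilinear form back along `id + tC` gives a curve that is quadratic in `t`. -/
lemma fderiv_apply_eq_of_hasDerivAt_quadratic {V : Type*} [NormedAddCommGroup V] [NormedSpace ℝ V]
    {F : V → ℝ} {a b d : V} {c : ℝ} (hF : DifferentiableAt ℝ F a)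
    (h : HasDerivAt (fun t : ℝ ↦ F (a + t • b + t ^ 2 • d)) c 0) : fderiv ℝ F a b = c := by
  have h1 := ((hasDerivAt_id (0 : ℝ)).smul_const b).const_add a
  have h2 := ((hasDerivAt_id (0 : ℝ)).pow 2).smul_const d
  have h3 : HasDerivAt (fun t : ℝ ↦ a + t • b + t ^ 2 • d) b 0 := by simpa using! h1.add h2
  exact (hF.hasFDerivAt.comp_hasDerivAt_of_eq 0 h3 (by simp)).unique h

/-- The derivative of the volume in the direction of the Lie derivative of the form along a
linear vector field. -/
lemma fderiv_volumeOfForm [FiniteDimensional ℝ E] (A : E →L[ℝ] E →L[ℝ] ℝ)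
    (b : Module.Basis (Fin (2 * n)) ℝ E) (C : E →L[ℝ] E) (v : Fin (2 * n) → E) :
    fderiv ℝ (fun A : E →L[ℝ] E →L[ℝ] ℝ ↦ volumeOfForm A v) A
      (A.bilinearComp C (.id ℝ E) + A.bilinearComp (.id ℝ E) C) =
      LinearMap.trace ℝ E C * volumeOfForm A v := by
  -- Along the curve `(id + tC)^* A` the volume is `det(id + tC)` times that of `A`, so no
  -- derivative of a Pfaffian has to be expanded.
  refine fderiv_apply_eq_of_hasDerivAt_quadratic (d := A.bilinearComp C C)
    (((contDiff_volumeOfForm v).differentiable (n := 1) one_ne_zero) A) ?_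
  refine ((hasDerivAt_det_one_add_smul b C).mul_const (volumeOfForm A v)).congr_of_eventuallyEq
    (Filter.Eventually.of_forall fun t ↦ ?_)
  beta_reduce
  rw [← volumeOfForm_comp_eq_det_mul A b, ← volumeOfForm_bilinearComp]
  congr 2
  ext x y
  simp
  ring

end TopPower
end


/-! ### Hamiltonian fields in a vector space: Lie derivative and divergence. -/

noncomputable section

section HamiltonianDivergence

open MeasureTheory Set Filter Topology

set_option synthInstance.maxHeartbeats 200000

variable {E : Type*} [NormedAddCommGroup E] [NormedSpace ℝ E]

/-- The Lie derivative of a closed `2`-form along a Hamiltonian vector field vanishes. -/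
lemma fderiv_form_apply_hamiltonian {A : E → E →L[ℝ] E →L[ℝ] ℝ} {X : E → E} {f : E → ℝ} {z : E}
    (hA : DifferentiableAt ℝ A z) (hX : DifferentiableAt ℝ X z) (hf : ContDiffAt ℝ 2 f z)
    (hskew : ∀ᶠ y in 𝓝 z, ∀ a b, A y a b = -A y b a)
    (hclosed : ∀ a b c, fderiv ℝ A z a b c + fderiv ℝ A z b c a + fderiv ℝ A z c a b = 0)
    (hXf : ∀ᶠ y in 𝓝 z, A y (X y) = fderiv ℝ f y) :
    fderiv ℝ A z (X z) = -((A z).bilinearComp (fderiv ℝ X z) (.id ℝ E) +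
      (A z).bilinearComp (.id ℝ E) (fderiv ℝ X z)) := by
  have hskew' : ∀ v a b, fderiv ℝ A z v a b = -fderiv ℝ A z v b a := by
    intro v a b
    have h1 := fun a b : E ↦ (hA.hasFDerivAt.clm_apply (hasFDerivAt_const a z)).clm_apply
      (hasFDerivAt_const b z)
    have h2 := (h1 a b).unique ((h1 b a).neg.congr_of_eventuallyEq
      (hskew.mono fun y hy ↦ hy a b))
    simpa using congrArg (fun l : E →L[ℝ] ℝ ↦ l v) h2
  -- This is the derivative of the identity `A(X) = df`.
  have hD : ∀ v w, fderiv ℝ (fderiv ℝ f) z v w = fderiv ℝ A z v (X z) w +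
      A z (fderiv ℝ X z v) w := by
    intro v w
    have h1 := hA.hasFDerivAt.clm_apply hX.hasFDerivAt
    have h2 : fderiv ℝ (fderiv ℝ f) z = _ :=
      (h1.congr_of_eventuallyEq (hXf.mono fun y hy ↦ hy.symm)).fderiv
    rw [h2]
    simp [add_comm]
  have hsymm := hf.isSymmSndFDerivAt (by simp)
  ext v w
  have e1 := hD v w
  have e2 := hD w v
  have e3 := hsymm.eq v w
  have e4 := hclosed (X z) v w
  have e5 := hskew' v (X z) w
  have e6 := hskew.self_of_nhds v (fderiv ℝ X z w)
  simp only [neg_apply, add_apply, ContinuousLinearMap.bilinearComp_apply,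
    ContinuousLinearMap.id_apply]
  -- Closedness and skewness give `A'(X)(v, w) = A'(v)(X, w) - A'(w)(X, v)`. Inserting `hD` on the
  -- right, the Hessian of `f` cancels by symmetry and `-A(DX v, w) + A(DX w, v)` is left.
  linarith

lemma trace_eq_sum_coord {ι : Type*} [Fintype ι] [FiniteDimensional ℝ E] (b : Module.Basis ι ℝ E)
    (C : E →L[ℝ] E) : LinearMap.trace ℝ E C = ∑ i, b.coord i (C (b i)) := by
  classical
  rw [LinearMap.trace_eq_matrix_trace ℝ b, Matrix.trace]
  simp [LinearMap.toMatrix_apply]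

lemma fderiv_fun_comp_apply {V W : Type*} [NormedAddCommGroup V] [NormedSpace ℝ V]
    [NormedAddCommGroup W] [NormedSpace ℝ W] {F : V → W} {g : E → V} {z : E}
    (hF : DifferentiableAt ℝ F (g z)) (hg : DifferentiableAt ℝ g z) (x : E) :
    fderiv ℝ (fun y ↦ F (g y)) z x = fderiv ℝ F (g z) (fderiv ℝ g z x) :=
  congrArg (fun l : E →L[ℝ] W ↦ l x) (fderiv_comp z hF hg)

/-- The density of the top power of a closed form is transported by Hamiltonian fields. -/
lemma fderiv_volumeOfForm_hamiltonian [FiniteDimensional ℝ E] {n : ℕ}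
    (b : Module.Basis (Fin (2 * n)) ℝ E) (v : Fin (2 * n) → E)
    {A : E → E →L[ℝ] E →L[ℝ] ℝ} {X : E → E} {f : E → ℝ} {z : E}
    (hA : DifferentiableAt ℝ A z) (hX : DifferentiableAt ℝ X z) (hf : ContDiffAt ℝ 2 f z)
    (hskew : ∀ᶠ y in 𝓝 z, ∀ a b, A y a b = -A y b a)
    (hclosed : ∀ a b c, fderiv ℝ A z a b c + fderiv ℝ A z b c a + fderiv ℝ A z c a b = 0)
    (hXf : ∀ᶠ y in 𝓝 z, A y (X y) = fderiv ℝ f y) :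
    fderiv ℝ (fun y ↦ volumeOfForm (A y) v) z (X z) =
      -(LinearMap.trace ℝ E (fderiv ℝ X z) * volumeOfForm (A z) v) := by
  have hF : DifferentiableAt ℝ (fun A : E →L[ℝ] E →L[ℝ] ℝ ↦ volumeOfForm A v) (A z) :=
    ((contDiff_volumeOfForm v).differentiable (n := 1) one_ne_zero) _
  refine (fderiv_fun_comp_apply (F := fun A : E →L[ℝ] E →L[ℝ] ℝ ↦ volumeOfForm A v)
    (g := A) hF hA (X z)).trans ?_
  rw [fderiv_form_apply_hamiltonian hA hX hf hskew hclosed hXf]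
  exact (map_neg _ _).trans (congrArg Neg.neg (fderiv_volumeOfForm _ b _ _))

section Integral

variable [FiniteDimensional ℝ E] [MeasurableSpace E] [BorelSpace E] (μ : Measure E)
  [μ.IsAddHaarMeasure]
  {F : Type*} [NormedAddCommGroup F] [NormedSpace ℝ F]

/-- Integration by parts against the constant function `1`. -/
lemma integral_fderiv_apply_eq_zero {w : E → F} (hw : ContDiff ℝ 1 w) (hc : HasCompactSupport w)
    (v : E) : ∫ z, fderiv ℝ w z v ∂μ = 0 := by
  have hi : Integrable (fun z ↦ fderiv ℝ w z v) μ :=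
    ((hw.continuous_fderiv one_ne_zero).clm_apply continuous_const).integrable_of_hasCompactSupport
      (hc.fderiv_apply ℝ v)
  have h := integral_smul_fderiv_eq_neg_fderiv_smul_of_integrable (μ := μ) (𝕜 := ℝ)
    (f := fun _ : E ↦ (1 : ℝ)) (g := w) (v := v) (by simp) (by simpa using hi)
    (by simpa using hw.continuous.integrable_of_hasCompactSupport hc)
    (fun x _ ↦ differentiableAt_const _) (fun x _ ↦ hw.differentiable one_ne_zero x)
  simpa using h

variable {μ} in
omit [NormedSpace ℝ E] [FiniteDimensional ℝ E] [NormedSpace ℝ F] in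
lemma integrable_of_continuousOn_of_tsupport {G : Type*} [NormedAddCommGroup G]
    {T : Set E} {u : E → F} (hc : HasCompactSupport u)
    (hT : tsupport u ⊆ T) {g : E → G} (hg : ContinuousOn g T) (h0 : ∀ z ∉ tsupport u, g z = 0) :
    Integrable g μ := by
  rw [← integrableOn_iff_integrable_of_support_subset (s := tsupport u)
    (fun z hz ↦ by by_contra h; exact hz (h0 z h))]
  exact (hg.mono hT).integrableOn_compact hc

/-- The divergence theorem for the field `u Y` with `u` compactly supported. -/
lemma integral_fderiv_add_trace_smul {T : Set E} (hTo : IsOpen T) {u : E → F} (hu : ContDiff ℝ 1 u)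
    (hc : HasCompactSupport u) (hT : tsupport u ⊆ T) {Y : E → E} (hY : ContDiffOn ℝ 1 Y T) :
    ∫ z, (fderiv ℝ u z (Y z) + LinearMap.trace ℝ E (fderiv ℝ Y z) • u z) ∂μ = 0 := by
  let b := Module.finBasis ℝ E
  let c : ∀ i, E →L[ℝ] ℝ := fun i ↦ LinearMap.toContinuousLinearMap (b.coord i)
  -- Although `Y` is only controlled on `T`, the product is `C¹` everywhere because `u` vanishes
  -- near each point outside its topological support.
  have hw : ∀ i, ContDiff ℝ 1 (fun z ↦ c i (Y z) • u z) := by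
    intro i
    rw [contDiff_iff_contDiffAt]
    intro z
    by_cases hz : z ∈ tsupport u
    · have h1 : ContDiffAt ℝ 1 Y z := hY.contDiffAt (hTo.mem_nhds (hT hz))
      exact ((c i).contDiff.contDiffAt.comp z h1).smul hu.contDiffAt
    · have : (fun z ↦ c i (Y z) • u z) =ᶠ[𝓝 z] fun _ ↦ 0 := by
        filter_upwards [notMem_tsupport_iff_eventuallyEq.1 hz] with y hy
        simp [hy]
      exact contDiffAt_const.congr_of_eventuallyEq this
  have hwc : ∀ i, HasCompactSupport (fun z ↦ c i (Y z) • u z) := fun i ↦ hc.smul_left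
  -- The integrand is the sum of the derivatives of `Yⁱ u` in the directions `bᵢ`, by the product
  -- rule.
  have hpt : ∀ z, fderiv ℝ u z (Y z) + LinearMap.trace ℝ E (fderiv ℝ Y z) • u z =
      ∑ i, fderiv ℝ (fun z ↦ c i (Y z) • u z) z (b i) := by
    intro z
    by_cases hz : z ∈ tsupport u
    · have h1 : DifferentiableAt ℝ Y z :=
        (hY.contDiffAt (hTo.mem_nhds (hT hz))).differentiableAt one_ne_zero
      have h2 : ∀ i, fderiv ℝ (fun z ↦ c i (Y z) • u z) z (b i) =
          c i (Y z) • fderiv ℝ u z (b i) + c i (fderiv ℝ Y z (b i)) • u z := by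
        intro i
        have := ((c i).hasFDerivAt.comp z h1.hasFDerivAt).smul
          (hu.differentiable one_ne_zero z).hasFDerivAt
        have h3 : fderiv ℝ (fun z ↦ c i (Y z) • u z) z = _ := this.fderiv
        rw [h3]
        simp
      simp only [h2, Finset.sum_add_distrib, ← Finset.sum_smul]
      rw [trace_eq_sum_coord b]
      congr 1
      conv_lhs => rw [← b.sum_repr (Y z), map_sum]
      simp [c]
    · have hz' := notMem_tsupport_iff_eventuallyEq.1 hz
      have h1 : fderiv ℝ u z = 0 := by
        rw [hz'.fderiv_eq]; exact fderiv_const_apply (0 : F)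
      have h2 : ∀ i, fderiv ℝ (fun z ↦ c i (Y z) • u z) z = 0 := by
        intro i
        have : (fun z ↦ c i (Y z) • u z) =ᶠ[𝓝 z] fun _ ↦ 0 := hz'.mono fun y hy ↦ by simp [hy]
        rw [this.fderiv_eq]; exact fderiv_const_apply (0 : F)
      have h3 : u z = 0 := image_eq_zero_of_notMem_tsupport hz
      simp [h1, h2, h3]
  simp only [hpt]
  rw [integral_finsetSum _ fun i _ ↦
    (((hw i).continuous_fderiv one_ne_zero).clm_apply
      continuous_const).integrable_of_hasCompactSupport ((hwc i).fderiv_apply ℝ (b i))]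
  exact Finset.sum_eq_zero fun i _ ↦ integral_fderiv_apply_eq_zero μ (hw i) (hwc i) (b i)

/-- Fields that preserve the density `P` are divergence free for the density `|P|`. -/
lemma integral_abs_smul_fderiv_eq_zero {T : Set E} (hTo : IsOpen T) {u : E → F}
    (hu : ContDiff ℝ 1 u) (hc : HasCompactSupport u) (hT : tsupport u ⊆ T) {X : E → E}
    (hX : ContDiffOn ℝ 1 X T) {P : E → ℝ} (hP : ContDiffOn ℝ 1 P T)
    (hPX : ∀ z ∈ T, fderiv ℝ P z (X z) = -(LinearMap.trace ℝ E (fderiv ℝ X z) * P z)) :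
    ∫ z, |P z| • fderiv ℝ u z (X z) ∂μ = 0 := by
  have htr : Continuous (fun C : E →L[ℝ] E ↦ LinearMap.trace ℝ E C) :=
    LinearMap.continuous_of_finiteDimensional
      ((LinearMap.trace ℝ E).comp (ContinuousLinearMap.coeLM ℝ))
  have hdX : ContinuousOn (fun z ↦ LinearMap.trace ℝ E (fderiv ℝ X z)) T :=
    htr.comp_continuousOn (hX.continuousOn_fderiv_of_isOpen hTo le_rfl)
  have hdu : ContinuousOn (fun z ↦ fderiv ℝ u z (X z)) T :=
    (hu.continuous_fderiv one_ne_zero).continuousOn.clm_apply hX.continuousOn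
  have hu0 : ∀ z ∉ tsupport u, u z = 0 := fun z hz ↦ image_eq_zero_of_notMem_tsupport hz
  have hdu0 : ∀ z ∉ tsupport u, fderiv ℝ u z (X z) = 0 := fun z hz ↦ by
    rw [(notMem_tsupport_iff_eventuallyEq.1 hz).fderiv_eq]
    have : fderiv ℝ (0 : E → F) z = 0 := fderiv_const_apply (0 : F)
    rw [this]; rfl
  set K := ∫ z, ‖fderiv ℝ u z (X z)‖ ∂μ + ∫ z, ‖LinearMap.trace ℝ E (fderiv ℝ X z) • u z‖ ∂μ
  have hi1 : Integrable (fun z ↦ fderiv ℝ u z (X z)) μ :=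
    integrable_of_continuousOn_of_tsupport hc hT hdu hdu0
  have hi2 : Integrable (fun z ↦ LinearMap.trace ℝ E (fderiv ℝ X z) • u z) μ :=
    integrable_of_continuousOn_of_tsupport hc hT (hdX.smul hu.continuous.continuousOn)
      fun z hz ↦ by simp [hu0 z hz]
  -- The function `|P|` need not be differentiable, so it is approximated by `ρ = √(P² + ε²)`, which
  -- is `C¹` on `T` and satisfies `|P| ≤ ρ ≤ |P| + ε`.
  have key : ∀ ε > 0, ‖∫ z, |P z| • fderiv ℝ u z (X z) ∂μ‖ ≤ ε * K := by
    intro ε hε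
    set ρ : E → ℝ := fun z ↦ √(P z ^ 2 + ε ^ 2) with hρ
    have hpos : ∀ z, 0 < P z ^ 2 + ε ^ 2 := fun z ↦ by positivity
    have hρpos : ∀ z, 0 < ρ z := fun z ↦ Real.sqrt_pos.2 (hpos z)
    have hsq : ∀ z, ρ z * ρ z = P z ^ 2 + ε ^ 2 := fun z ↦ Real.mul_self_sqrt (hpos z).le
    have hρc : ContDiffOn ℝ 1 ρ T := ((hP.pow 2).add contDiffOn_const).sqrt fun z _ ↦ (hpos z).ne'
    have hερ : ∀ z, ε ≤ ρ z := fun z ↦ Real.le_sqrt_of_sq_le (by nlinarith [sq_nonneg (P z)])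
    have hPρ : ∀ z, |P z| ≤ ρ z := fun z ↦ Real.abs_le_sqrt (by nlinarith [sq_nonneg ε])
    have hρP : ∀ z, ρ z ≤ |P z| + ε := fun z ↦ by
      refine (Real.sqrt_le_left (by positivity)).2 ?_
      nlinarith [sq_abs (P z), abs_nonneg (P z)]
    have hdiv := integral_fderiv_add_trace_smul μ hTo hu hc hT (hρc.smul hX)
    -- The field `ρ X` is almost divergence free: its divergence is `(ρ - P²/ρ) tr(DX) = (ε²/ρ)
    -- tr(DX)`, of absolute value at most `ε |tr(DX)|`.
    have hpt : ∀ z, fderiv ℝ u z ((ρ • X) z) + LinearMap.trace ℝ E (fderiv ℝ (ρ • X) z) • u z =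
        ρ z • fderiv ℝ u z (X z) +
          (ε ^ 2 / ρ z) • LinearMap.trace ℝ E (fderiv ℝ X z) • u z := by
      intro z
      by_cases hz : z ∈ tsupport u
      · have hzT := hTo.mem_nhds (hT hz)
        have h1 : DifferentiableAt ℝ X z := (hX.contDiffAt hzT).differentiableAt one_ne_zero
        have h2 : DifferentiableAt ℝ ρ z := (hρc.contDiffAt hzT).differentiableAt one_ne_zero
        have h3 : DifferentiableAt ℝ P z := (hP.contDiffAt hzT).differentiableAt one_ne_zero
        -- Differentiate `ρ² = P² + ε²` along `X` and use `hPX`.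
        have h4 : ρ z * fderiv ℝ ρ z (X z) =
            -(LinearMap.trace ℝ E (fderiv ℝ X z) * P z ^ 2) := by
          have e1 := (h2.hasFDerivAt.mul h2.hasFDerivAt).congr_of_eventuallyEq
            (f₁ := fun z ↦ P z ^ 2 + ε ^ 2) (Eventually.of_forall fun y ↦ (hsq y).symm)
          have e2 := e1.unique ((h3.hasFDerivAt.pow 2).add_const (ε ^ 2))
          have e3 := congrArg (fun l : E →L[ℝ] ℝ ↦ l (X z)) e2
          simp [hPX z (hT hz)] at e3
          linarith
        have h5 : LinearMap.trace ℝ E (fderiv ℝ (ρ • X) z) =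
            fderiv ℝ ρ z (X z) + ρ z * LinearMap.trace ℝ E (fderiv ℝ X z) := by
          rw [fderiv_smul h2 h1]
          have : ((ρ z • fderiv ℝ X z + (fderiv ℝ ρ z).smulRight (X z) : E →L[ℝ] E) : E →ₗ[ℝ] E) =
            ρ z • (fderiv ℝ X z : E →ₗ[ℝ] E) + ((fderiv ℝ ρ z : E →ₗ[ℝ] ℝ).smulRight (X z)) := rfl
          rw [this, map_add, map_smul, LinearMap.trace_smulRight]
          simp [add_comm]
        have h6 : fderiv ℝ ρ z (X z) + ρ z * LinearMap.trace ℝ E (fderiv ℝ X z) =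
            ε ^ 2 / ρ z * LinearMap.trace ℝ E (fderiv ℝ X z) := by
          have := (hρpos z).ne'
          field_simp
          have := hsq z
          linear_combination h4 + LinearMap.trace ℝ E (fderiv ℝ X z) * this
        rw [h5, h6, mul_smul]
        simp
      · simp [hu0 z hz, hdu0 z hz]
    have hi3 : Integrable (fun z ↦ ρ z • fderiv ℝ u z (X z)) μ :=
      integrable_of_continuousOn_of_tsupport hc hT (hρc.continuousOn.smul hdu)
        fun z hz ↦ by simp [hdu0 z hz]
    have hi4 : Integrable (fun z ↦ (ε ^ 2 / ρ z) • LinearMap.trace ℝ E (fderiv ℝ X z) • u z) μ :=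
      integrable_of_continuousOn_of_tsupport hc hT
        ((continuousOn_const.div hρc.continuousOn fun z _ ↦ (hρpos z).ne').smul
          (hdX.smul hu.continuous.continuousOn)) fun z hz ↦ by simp [hu0 z hz]
    have hi5 : Integrable (fun z ↦ |P z| • fderiv ℝ u z (X z)) μ :=
      integrable_of_continuousOn_of_tsupport hc hT (hP.continuousOn.abs.smul hdu)
        fun z hz ↦ by simp [hdu0 z hz]
    simp only [hpt] at hdiv
    rw [integral_add hi3 hi4] at hdiv
    -- Both errors are `O(ε)`: in the first `||P| - ρ| ≤ ε`, in the second `ε²/ρ ≤ ε`.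
    have e : ∫ z, |P z| • fderiv ℝ u z (X z) ∂μ =
        ∫ z, (|P z| - ρ z) • fderiv ℝ u z (X z) ∂μ -
          ∫ z, (ε ^ 2 / ρ z) • LinearMap.trace ℝ E (fderiv ℝ X z) • u z ∂μ := by
      simp only [sub_smul]
      rw [integral_sub hi5 hi3, sub_sub, hdiv, sub_zero]
    rw [e]
    refine (norm_sub_le _ _).trans ?_
    rw [mul_add, ← integral_const_mul, ← integral_const_mul]
    refine add_le_add (norm_integral_le_of_norm_le (hi1.norm.const_mul ε) (ae_of_all _ fun z ↦ ?_))
      (norm_integral_le_of_norm_le (hi2.norm.const_mul ε) (ae_of_all _ fun z ↦ ?_))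
    · rw [norm_smul]
      gcongr
      rw [Real.norm_eq_abs, abs_le]
      constructor <;> linarith [hPρ z, hρP z]
    · rw [norm_smul]
      gcongr
      rw [Real.norm_eq_abs, abs_of_nonneg (by have := hρpos z; positivity),
        div_le_iff₀ (hρpos z), sq]
      exact mul_le_mul_of_nonneg_left (hερ z) hε.le
  have hK : 0 ≤ K := add_nonneg (integral_nonneg fun _ ↦ norm_nonneg _)
    (integral_nonneg fun _ ↦ norm_nonneg _)
  refine norm_le_zero_iff.1 (le_of_forall_pos_le_add fun δ hδ ↦ ?_)
  -- The summand `1` keeps the denominator positive when `K = 0`.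
  refine (key (δ / (K + 1)) (by positivity)).trans ?_
  rw [div_mul_eq_mul_div, zero_add, div_le_iff₀ (by positivity)]
  nlinarith

end Integral

end HamiltonianDivergence
end


/-! ### Vector fields, derivatives and Lie brackets in charts. -/

noncomputable section

section ChartCalculus

open Set Filter Topology VectorField

variable {E : Type*} [NormedAddCommGroup E] [NormedSpace ℝ E] {M : Type*} [TopologicalSpace M]
  [ChartedSpace E M] [IsManifold 𝓘(ℝ, E) ∞ M] {F : Type*} [NormedAddCommGroup F] [NormedSpace ℝ F]

lemma minSmoothness_two_le_infty : minSmoothness ℝ 2 ≤ ∞ := by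
  rw [minSmoothness_of_isRCLikeNormedField]
  exact WithTop.coe_le_coe.2 (le_top : (2 : ℕ∞) ≤ ⊤)

lemma mlieBracket_eq_lieBracket {V W : ∀ x : E, TangentSpace 𝓘(ℝ, E) x} (x : E) :
    mlieBracket 𝓘(ℝ, E) V W x = lieBracket ℝ V W x := by
  rw [← mlieBracketWithin_univ]
  exact (congrFun mlieBracketWithin_eq_lieBracketWithin x).trans
    (congrFun (lieBracketWithin_univ (𝕜 := ℝ) (E := E)) x)

omit [NormedSpace ℝ E] [IsManifold 𝓘(ℝ, E) ∞ M] in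
lemma chartAt_mem_nhds_target {p : M} {z : E} (hz : z ∈ (chartAt E p).target) :
    (chartAt E p).target ∈ 𝓝 z := (chartAt E p).open_target.mem_nhds hz

omit [NormedSpace ℝ E] [IsManifold 𝓘(ℝ, E) ∞ M] in
lemma chartAt_mem_nhds_source {p x : M} (hx : x ∈ (chartAt E p).source) :
    (chartAt E p).source ∈ 𝓝 x := (chartAt E p).open_source.mem_nhds hx

lemma mdifferentiable_chartAt (p : M) :
    (chartAt E p).MDifferentiable 𝓘(ℝ, E) 𝓘(ℝ, E) := by
  have : IsManifold 𝓘(ℝ, E) 1 M := .of_le (n := ∞) (by simp)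
  exact mdifferentiable_chart p

lemma mfderiv_chartAt_comp_symm {p : M} {z : E} (hz : z ∈ (chartAt E p).target) :
    (mfderiv 𝓘(ℝ, E) 𝓘(ℝ, E) (chartAt E p) ((chartAt E p).symm z)).comp
      (mfderiv 𝓘(ℝ, E) 𝓘(ℝ, E) (chartAt E p).symm z) = .id ℝ E :=
  (mdifferentiable_chartAt p).comp_symm_deriv hz

lemma mfderiv_chartAt_symm_comp {p : M} {z : E} (hz : z ∈ (chartAt E p).target) :
    (mfderiv 𝓘(ℝ, E) 𝓘(ℝ, E) (chartAt E p).symm z).comp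
      (mfderiv 𝓘(ℝ, E) 𝓘(ℝ, E) (chartAt E p) ((chartAt E p).symm z)) =
      .id ℝ (TangentSpace 𝓘(ℝ, E) ((chartAt E p).symm z)) := by
  have h := (mdifferentiable_chartAt p).symm_comp_deriv ((chartAt E p).map_target hz)
  rwa [(chartAt E p).right_inv hz] at h

lemma isInvertible_mfderiv_chartAt_symm {p : M} {z : E} (hz : z ∈ (chartAt E p).target) :
    (mfderiv 𝓘(ℝ, E) 𝓘(ℝ, E) (chartAt E p).symm z).IsInvertible :=
  ⟨.equivOfInverse' _ _ (mfderiv_chartAt_symm_comp hz) (mfderiv_chartAt_comp_symm hz), rfl⟩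

lemma isInvertible_mfderiv_chartAt {p x : M} (hx : x ∈ (chartAt E p).source) :
    (mfderiv 𝓘(ℝ, E) 𝓘(ℝ, E) (chartAt E p) x).IsInvertible := by
  have h1 := mfderiv_chartAt_symm_comp ((chartAt E p).map_source hx)
  have h2 := mfderiv_chartAt_comp_symm ((chartAt E p).map_source hx)
  rw [(chartAt E p).left_inv hx] at h1 h2
  exact ⟨.equivOfInverse' _ _ h2 h1, rfl⟩

lemma inverse_mfderiv_chartAt {p x : M} (hx : x ∈ (chartAt E p).source) :
    (mfderiv 𝓘(ℝ, E) 𝓘(ℝ, E) (chartAt E p) x).inverse =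
      mfderiv 𝓘(ℝ, E) 𝓘(ℝ, E) (chartAt E p).symm (chartAt E p x) := by
  have h1 := mfderiv_chartAt_symm_comp ((chartAt E p).map_source hx)
  have h2 := mfderiv_chartAt_comp_symm ((chartAt E p).map_source hx)
  rw [(chartAt E p).left_inv hx] at h1 h2
  exact ContinuousLinearMap.inverse_eq h2 h1

/-- The vector field `V` in the coordinates of the chart at `p`. -/
def fieldInChart (p : M) (V : ∀ x : M, TangentSpace 𝓘(ℝ, E) x) (z : E) : E :=
  mpullback 𝓘(ℝ, E) 𝓘(ℝ, E) (chartAt E p).symm V z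

/-- The vector field with constant coefficients `v` in the coordinates of the chart at `p`. -/
def coordinateField (p : M) (v : E) (x : M) : TangentSpace 𝓘(ℝ, E) x :=
  mpullback 𝓘(ℝ, E) 𝓘(ℝ, E) (chartAt E p) (fun _ ↦ v) x

lemma coordinateField_symm {p : M} (v : E) {z : E} (hz : z ∈ (chartAt E p).target) :
    coordinateField p v ((chartAt E p).symm z) =
      mfderiv 𝓘(ℝ, E) 𝓘(ℝ, E) (chartAt E p).symm z v := by
  have h := inverse_mfderiv_chartAt ((chartAt E p).map_target hz)
  rw [(chartAt E p).right_inv hz] at h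
  exact congrArg (fun l : E →L[ℝ] TangentSpace 𝓘(ℝ, E) ((chartAt E p).symm z) ↦ l v) h

lemma mfderiv_symm_fieldInChart {p : M} (V : ∀ x : M, TangentSpace 𝓘(ℝ, E) x) {z : E}
    (hz : z ∈ (chartAt E p).target) :
    mfderiv 𝓘(ℝ, E) 𝓘(ℝ, E) (chartAt E p).symm z (fieldInChart (E := E) p V z) =
      V ((chartAt E p).symm z) :=
  (isInvertible_mfderiv_chartAt_symm hz).self_apply_inverse _

lemma fieldInChart_eq_of_eq {p : M} (V : ∀ x : M, TangentSpace 𝓘(ℝ, E) x) {z v : E}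
    (hz : z ∈ (chartAt E p).target)
    (h : V ((chartAt E p).symm z) = mfderiv 𝓘(ℝ, E) 𝓘(ℝ, E) (chartAt E p).symm z v) :
    fieldInChart p V z = v := by
  rw [fieldInChart, mpullback_apply, h]
  exact (isInvertible_mfderiv_chartAt_symm hz).inverse_apply_self _

variable [CompleteSpace E]

lemma contMDiffOn_coordinateField (p : M) (v : E) :
    ContMDiffOn 𝓘(ℝ, E) (𝓘(ℝ, E).prod 𝓘(ℝ, E)) ∞
      (fun x ↦ Bundle.TotalSpace.mk' E (E := (TangentSpace 𝓘(ℝ, E) : M → Type _)) x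
        (coordinateField p v x)) (chartAt E p).source := by
  intro x hx
  refine ContMDiffAt.contMDiffWithinAt ?_
  refine ContMDiffAt.mpullback_vectorField_preimage (n := ∞) ?_
    (contMDiffOn_chart.contMDiffAt (chartAt_mem_nhds_source hx))
    (isInvertible_mfderiv_chartAt hx) (by simp)
  exact contMDiffAt_vectorSpace_iff_contDiffAt.2 contDiffAt_const

lemma contDiffOn_fieldInChart (p : M) {V : ∀ x : M, TangentSpace 𝓘(ℝ, E) x}
    (hV : ContMDiff 𝓘(ℝ, E) (𝓘(ℝ, E).prod 𝓘(ℝ, E)) ∞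
      (fun x ↦ Bundle.TotalSpace.mk' E (E := (TangentSpace 𝓘(ℝ, E) : M → Type _)) x (V x))) :
    ContDiffOn ℝ ∞ (fieldInChart p V) (chartAt E p).target := by
  intro z hz
  refine ContDiffAt.contDiffWithinAt (contMDiffAt_vectorSpace_iff_contDiffAt.1 ?_)
  exact ContMDiffAt.mpullback_vectorField_preimage (n := ∞) (hV _)
    (contMDiffOn_chart_symm.contMDiffAt (chartAt_mem_nhds_target hz))
    (isInvertible_mfderiv_chartAt_symm hz) (by simp)

omit [CompleteSpace E] in
lemma contDiffOn_comp_chartAt_symm {p : M} {g : M → F} (hg : ContMDiff 𝓘(ℝ, E) 𝓘(ℝ, F) ∞ g) :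
    ContDiffOn ℝ ∞ (g ∘ (chartAt E p).symm) (chartAt E p).target :=
  contMDiffOn_iff_contDiffOn.1 (hg.comp_contMDiffOn contMDiffOn_chart_symm)

omit [CompleteSpace E] in
lemma fderiv_comp_chartAt_symm {p : M} {g : M → F} {z : E} (hz : z ∈ (chartAt E p).target)
    (hg : MDifferentiableAt 𝓘(ℝ, E) 𝓘(ℝ, F) g ((chartAt E p).symm z)) (v : E) :
    fderiv ℝ (g ∘ (chartAt E p).symm) z v =
      mvfderiv 𝓘(ℝ, E) g ((chartAt E p).symm z)
        (mfderiv 𝓘(ℝ, E) 𝓘(ℝ, E) (chartAt E p).symm z v) := by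
  rw [← mfderiv_eq_fderiv, mfderiv_comp z hg ((mdifferentiable_chartAt p).mdifferentiableAt_symm hz)]
  rfl

omit [CompleteSpace E] in
lemma fderiv_comp_chartAt_symm_fieldInChart {p : M} {g : M → F} {z : E}
    (hz : z ∈ (chartAt E p).target)
    (hg : MDifferentiableAt 𝓘(ℝ, E) 𝓘(ℝ, F) g ((chartAt E p).symm z))
    (V : ∀ x : M, TangentSpace 𝓘(ℝ, E) x) :
    fderiv ℝ (g ∘ (chartAt E p).symm) z (fieldInChart p V z) =
      mvfderiv 𝓘(ℝ, E) g ((chartAt E p).symm z) (V ((chartAt E p).symm z)) := by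
  rw [fderiv_comp_chartAt_symm hz hg, mfderiv_symm_fieldInChart V hz]

/-- In the chart at `p` the function is the ordinary derivative of a smooth map applied to a smooth
field. -/
lemma contMDiff_mvfderiv_apply {g : M → F} (hg : ContMDiff 𝓘(ℝ, E) 𝓘(ℝ, F) ∞ g)
    {V : ∀ x : M, TangentSpace 𝓘(ℝ, E) x}
    (hV : ContMDiff 𝓘(ℝ, E) (𝓘(ℝ, E).prod 𝓘(ℝ, E)) ∞
      (fun x ↦ Bundle.TotalSpace.mk' E (E := (TangentSpace 𝓘(ℝ, E) : M → Type _)) x (V x))) :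
    ContMDiff 𝓘(ℝ, E) 𝓘(ℝ, F) ∞ (fun x ↦ mvfderiv 𝓘(ℝ, E) g x (V x)) := by
  intro p
  have hp := mem_chart_source E p
  have h1 : ContDiffOn ℝ ∞ (fun z ↦ fderiv ℝ (g ∘ (chartAt E p).symm) z (fieldInChart p V z))
      (chartAt E p).target :=
    ((contDiffOn_comp_chartAt_symm hg).fderiv_of_isOpen (chartAt E p).open_target
      (m := ∞) (by simp)).clm_apply (contDiffOn_fieldInChart p hV)
  have h2 : ContMDiffAt 𝓘(ℝ, E) 𝓘(ℝ, F) ∞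
      ((fun z ↦ fderiv ℝ (g ∘ (chartAt E p).symm) z (fieldInChart p V z)) ∘ chartAt E p) p :=
    ContMDiffAt.comp p (h1.contDiffAt (chartAt_mem_nhds_target
      ((chartAt E p).map_source hp))).contMDiffAt
      (contMDiffOn_chart.contMDiffAt (chartAt_mem_nhds_source hp))
  refine h2.congr_of_eventuallyEq ?_
  filter_upwards [chartAt_mem_nhds_source hp] with x hx
  have hz := (chartAt E p).map_source hx
  have := fderiv_comp_chartAt_symm_fieldInChart hz
    (hg.mdifferentiable (by simp) ((chartAt E p).symm (chartAt E p x))) V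
  rw [(chartAt E p).left_inv hx] at this
  exact this.symm

/-- Lie brackets commute with pullback along the inverse chart; pushing the pulled back bracket
forward again recovers the original. -/
lemma mlieBracket_chartAt_symm {p : M} {V W : ∀ x : M, TangentSpace 𝓘(ℝ, E) x}
    (hV : ContMDiff 𝓘(ℝ, E) (𝓘(ℝ, E).prod 𝓘(ℝ, E)) ∞
      (fun x ↦ Bundle.TotalSpace.mk' E (E := (TangentSpace 𝓘(ℝ, E) : M → Type _)) x (V x)))
    (hW : ContMDiff 𝓘(ℝ, E) (𝓘(ℝ, E).prod 𝓘(ℝ, E)) ∞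
      (fun x ↦ Bundle.TotalSpace.mk' E (E := (TangentSpace 𝓘(ℝ, E) : M → Type _)) x (W x)))
    {z : E} (hz : z ∈ (chartAt E p).target) :
    mlieBracket 𝓘(ℝ, E) V W ((chartAt E p).symm z) =
      mfderiv 𝓘(ℝ, E) 𝓘(ℝ, E) (chartAt E p).symm z
        (lieBracket ℝ (E := E) (fieldInChart p V) (fieldInChart p W) z) := by
  have : IsManifold 𝓘(ℝ, E) (minSmoothness ℝ 2) M := .of_le (n := ∞) minSmoothness_two_le_infty
  have h := mpullback_mlieBracket (n := ∞) (I := 𝓘(ℝ, E)) (I' := 𝓘(ℝ, E))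
    (f := (chartAt E p).symm) (x₀ := z) (V := V) (W := W)
    ((hV _).mdifferentiableAt (by simp)) ((hW _).mdifferentiableAt (by simp))
    (contMDiffOn_chart_symm.contMDiffAt (chartAt_mem_nhds_target hz)) minSmoothness_two_le_infty
  refine (mfderiv_symm_fieldInChart (mlieBracket 𝓘(ℝ, E) V W) hz).symm.trans ?_
  exact congrArg _ (h.trans (mlieBracket_eq_lieBracket z))

/-- The Lie bracket acts on functions as the commutator of derivations. -/
lemma mvfderiv_mlieBracket {g : M → F} (hg : ContMDiff 𝓘(ℝ, E) 𝓘(ℝ, F) ∞ g)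
    {V W : ∀ x : M, TangentSpace 𝓘(ℝ, E) x}
    (hV : ContMDiff 𝓘(ℝ, E) (𝓘(ℝ, E).prod 𝓘(ℝ, E)) ∞
      (fun x ↦ Bundle.TotalSpace.mk' E (E := (TangentSpace 𝓘(ℝ, E) : M → Type _)) x (V x)))
    (hW : ContMDiff 𝓘(ℝ, E) (𝓘(ℝ, E).prod 𝓘(ℝ, E)) ∞
      (fun x ↦ Bundle.TotalSpace.mk' E (E := (TangentSpace 𝓘(ℝ, E) : M → Type _)) x (W x)))
    (x : M) :
    mvfderiv 𝓘(ℝ, E) g x (mlieBracket 𝓘(ℝ, E) V W x) =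
      mvfderiv 𝓘(ℝ, E) (fun y ↦ mvfderiv 𝓘(ℝ, E) g y (W y)) x (V x) -
        mvfderiv 𝓘(ℝ, E) (fun y ↦ mvfderiv 𝓘(ℝ, E) g y (V y)) x (W x) := by
  obtain ⟨p, z, hz, rfl⟩ : ∃ p, ∃ z ∈ (chartAt E p).target, (chartAt E p).symm z = x :=
    ⟨x, _, mem_chart_target E x, (chartAt E x).left_inv (mem_chart_source E x)⟩
  have hgd := hg.mdifferentiable (n := ∞) (by simp)
  have e : ∀ U : ∀ x : M, TangentSpace 𝓘(ℝ, E) x,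
      (fun y ↦ mvfderiv 𝓘(ℝ, E) g y (U y)) ∘ (chartAt E p).symm =ᶠ[𝓝 z]
        fun y ↦ fderiv ℝ (g ∘ (chartAt E p).symm) y (fieldInChart p U y) := fun U ↦ by
    filter_upwards [chartAt_mem_nhds_target hz] with y hy
    exact (fderiv_comp_chartAt_symm_fieldInChart hy (hgd _) U).symm
  have hd : ∀ U : ∀ x : M, TangentSpace 𝓘(ℝ, E) x,
      ContMDiff 𝓘(ℝ, E) (𝓘(ℝ, E).prod 𝓘(ℝ, E)) ∞
      (fun x ↦ Bundle.TotalSpace.mk' E (E := (TangentSpace 𝓘(ℝ, E) : M → Type _)) x (U x)) →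
      DifferentiableAt ℝ (fieldInChart p U) z := fun U hU ↦
    ((contDiffOn_fieldInChart p hU).contDiffAt (chartAt_mem_nhds_target hz)).differentiableAt
      (by simp)
  rw [mlieBracket_chartAt_symm hV hW hz, ← fderiv_comp_chartAt_symm hz (hgd _),
    fderiv_apply_lieBracket (n := ∞)
      ((contDiffOn_comp_chartAt_symm hg).contDiffAt (chartAt_mem_nhds_target hz))
      minSmoothness_two_le_infty
      (hd W hW) (hd V hV),
    ← fderiv_comp_chartAt_symm_fieldInChart hz
      ((contMDiff_mvfderiv_apply hg hW).mdifferentiable (by simp) _) V,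
    ← fderiv_comp_chartAt_symm_fieldInChart hz
      ((contMDiff_mvfderiv_apply hg hV).mdifferentiable (by simp) _) W,
    (e W).fderiv_eq, (e V).fderiv_eq]

section Extension

variable [FiniteDimensional ℝ E] [T2Space M]

omit [CompleteSpace E] in
/-- Smooth cutoff functions. -/
lemma exists_contMDiff_eventuallyEq_one {U : Set M} (x : M) (hU : U ∈ 𝓝 x) :
    ∃ χ : M → ℝ, ContMDiff 𝓘(ℝ, E) 𝓘(ℝ, ℝ) ∞ χ ∧ χ =ᶠ[𝓝 x] 1 ∧ tsupport χ ⊆ U := by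
  obtain ⟨f, -, hf⟩ := (SmoothBumpFunction.nhds_basis_tsupport (I := 𝓘(ℝ, E)) x).mem_iff.1 hU
  exact ⟨f, f.contMDiff, f.eventuallyEq_one, hf⟩

/-- Closedness of `Ω` is stated for globally defined fields, so coordinate fields have to be cut off
before it can be used in a chart. -/
lemma exists_contMDiff_eventuallyEq_coordinateField {p x : M} (hx : x ∈ (chartAt E p).source)
    (v : E) : ∃ V : ∀ x : M, TangentSpace 𝓘(ℝ, E) x,
      ContMDiff 𝓘(ℝ, E) (𝓘(ℝ, E).prod 𝓘(ℝ, E)) ∞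
      (fun x ↦ Bundle.TotalSpace.mk' E (E := (TangentSpace 𝓘(ℝ, E) : M → Type _)) x (V x)) ∧
      ∀ᶠ y in 𝓝 x, V y = coordinateField p v y := by
  obtain ⟨χ, hχ, h1, hs⟩ := exists_contMDiff_eventuallyEq_one (E := E) x (chartAt_mem_nhds_source hx)
  refine ⟨fun y ↦ χ y • coordinateField p v y,
    ContMDiffOn.smul_section_of_tsupport hχ.contMDiffOn (chartAt E p).open_source hs
      (contMDiffOn_coordinateField p v), ?_⟩
  filter_upwards [h1] with y hy
  simp [hy]

end Extension

end ChartCalculus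
end


/-! ### The symplectic form in charts and brackets of Hamiltonian fields. -/

noncomputable section

section SymplecticCharts

open Set Filter Topology VectorField

set_option synthInstance.maxHeartbeats 200000

variable {n : ℕ} {M : Type*} [TopologicalSpace M]
  [ChartedSpace (EuclideanSpace ℝ (Fin (2 * n))) M] [IsManifold (𝓡 (2 * n)) ∞ M]

local notation "𝔼" => EuclideanSpace ℝ (Fin (2 * n))

namespace SymplecticForm

variable (Ω : SymplecticForm n M)

/-- The symplectic form at a point as a bilinear form on the model space. -/
def modelForm (x : M) : 𝔼 →L[ℝ] 𝔼 →L[ℝ] ℝ := Ω.toFun x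

/-- The symplectic form in the coordinates of the chart at `p`. -/
def formInChart (p : M) (z : 𝔼) : 𝔼 →L[ℝ] 𝔼 →L[ℝ] ℝ :=
  (Ω.modelForm ((chartAt 𝔼 p).symm z)).bilinearComp
    (mfderiv (𝓡 (2 * n)) (𝓡 (2 * n)) (chartAt 𝔼 p).symm z)
    (mfderiv (𝓡 (2 * n)) (𝓡 (2 * n)) (chartAt 𝔼 p).symm z)

lemma formInChart_apply (p : M) (z v w : 𝔼) :
    Ω.formInChart p z v w = Ω.toFun ((chartAt 𝔼 p).symm z)
      (mfderiv (𝓡 (2 * n)) (𝓡 (2 * n)) (chartAt 𝔼 p).symm z v)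
      (mfderiv (𝓡 (2 * n)) (𝓡 (2 * n)) (chartAt 𝔼 p).symm z w) := rfl

lemma toFun_swap (x : M) (v w : TangentSpace (𝓡 (2 * n)) x) :
    Ω.toFun x v w = -Ω.toFun x w v := by
  have h := Ω.alternating x (v + w)
  simp only [map_add, add_apply, Ω.alternating, zero_add, add_zero] at h
  linarith

lemma formInChart_swap (p : M) (z v w : 𝔼) :
    Ω.formInChart p z v w = -Ω.formInChart p z w v := Ω.toFun_swap _ _ _

lemma contMDiffOn_toFun_apply {s : Set M} {V W : ∀ x : M, TangentSpace (𝓡 (2 * n)) x}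
    (hV : ContMDiffOn (𝓡 (2 * n)) ((𝓡 (2 * n)).prod (𝓡 (2 * n))) ∞
      (fun x ↦ Bundle.TotalSpace.mk' 𝔼 (E := (TangentSpace (𝓡 (2 * n)) : M → Type _)) x (V x)) s)
    (hW : ContMDiffOn (𝓡 (2 * n)) ((𝓡 (2 * n)).prod (𝓡 (2 * n))) ∞
      (fun x ↦ Bundle.TotalSpace.mk' 𝔼 (E := (TangentSpace (𝓡 (2 * n)) : M → Type _)) x (W x)) s) :
    ContMDiffOn (𝓡 (2 * n)) 𝓘(ℝ, ℝ) ∞ (fun x ↦ Ω.toFun x (V x) (W x)) s := by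
  have h := ContMDiffOn.clm_bundle_apply₂ (E₃ := Bundle.Trivial M ℝ)
    (Ω.contMDiff_toFun.contMDiffOn (s := s)) hV hW
  intro x hx
  exact (Bundle.contMDiffWithinAt_section (E := Bundle.Trivial M ℝ)).1 (h x hx)

lemma contMDiff_toFun_apply {V W : ∀ x : M, TangentSpace (𝓡 (2 * n)) x}
    (hV : ContMDiff (𝓡 (2 * n)) ((𝓡 (2 * n)).prod (𝓡 (2 * n))) ∞
      (fun x ↦ Bundle.TotalSpace.mk' 𝔼 (E := (TangentSpace (𝓡 (2 * n)) : M → Type _)) x (V x)))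
    (hW : ContMDiff (𝓡 (2 * n)) ((𝓡 (2 * n)).prod (𝓡 (2 * n))) ∞
      (fun x ↦ Bundle.TotalSpace.mk' 𝔼 (E := (TangentSpace (𝓡 (2 * n)) : M → Type _)) x (W x))) :
    ContMDiff (𝓡 (2 * n)) 𝓘(ℝ, ℝ) ∞ (fun x ↦ Ω.toFun x (V x) (W x)) :=
  contMDiffOn_univ.1 (Ω.contMDiffOn_toFun_apply hV.contMDiffOn hW.contMDiffOn)

/-- In finite dimension smoothness can be tested on fixed vectors, and the entries are the values of
`Ω` on coordinate fields. -/
lemma contDiffOn_formInChart (p : M) :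
    ContDiffOn ℝ ∞ (Ω.formInChart p) (chartAt 𝔼 p).target := by
  refine contDiffOn_clm_apply.2 fun v ↦ contDiffOn_clm_apply.2 fun w ↦ ?_
  have h := contMDiffOn_iff_contDiffOn.1 ((Ω.contMDiffOn_toFun_apply
    (contMDiffOn_coordinateField p v) (contMDiffOn_coordinateField p w)).comp
    (contMDiffOn_chart_symm (I := 𝓡 (2 * n)) (x := p)) fun z hz ↦ (chartAt 𝔼 p).map_target hz)
  refine h.congr fun z hz ↦ ?_
  rw [formInChart_apply, Function.comp_apply, coordinateField_symm v hz, coordinateField_symm w hz]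

/-- Connects the density defining the Liouville measure with the linear algebra of `volumeOfForm`.
-/
lemma chartDensity_eq (p : M) (z : 𝔼) :
    Ω.chartDensity p z =
      |volumeOfForm (Ω.formInChart p z) fun i ↦ EuclideanSpace.single i (1 : ℝ)| := by
  rw [volumeOfForm_apply]
  rfl

lemma formInChart_fieldInChart (p : M) (f : C^∞⟮𝓡 (2 * n), M; ℝ⟯) {z : 𝔼}
    (hz : z ∈ (chartAt 𝔼 p).target) :
    Ω.formInChart p z (fieldInChart p (Ω.hamiltonianVectorField f) z) =
      fderiv ℝ (f ∘ (chartAt 𝔼 p).symm) z := by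
  ext v
  rw [fderiv_comp_chartAt_symm hz (f.contMDiff.mdifferentiable (by simp) _), formInChart_apply,
    mfderiv_symm_fieldInChart _ hz]
  exact congrArg (fun l : TangentSpace (𝓡 (2 * n)) ((chartAt 𝔼 p).symm z) →L[ℝ] ℝ ↦ l _)
    (Ω.toFun_hamiltonianField f _)

lemma toFun_hamiltonianVectorField (f : C^∞⟮𝓡 (2 * n), M; ℝ⟯) (x : M)
    (w : TangentSpace (𝓡 (2 * n)) x) :
    Ω.toFun x (Ω.hamiltonianVectorField f x) w = mvfderiv (𝓡 (2 * n)) f x w :=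
  congrArg (fun l : TangentSpace (𝓡 (2 * n)) x →L[ℝ] ℝ ↦ l w) (Ω.toFun_hamiltonianField f x)

lemma toFun_apply_hamiltonianVectorField (f : C^∞⟮𝓡 (2 * n), M; ℝ⟯) (x : M)
    (w : TangentSpace (𝓡 (2 * n)) x) :
    Ω.toFun x w (Ω.hamiltonianVectorField f x) = -mvfderiv (𝓡 (2 * n)) f x w := by
  rw [Ω.toFun_swap, toFun_hamiltonianVectorField]

lemma mvfderiv_hamiltonianVectorField_right (f g : C^∞⟮𝓡 (2 * n), M; ℝ⟯) (x : M) :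
    mvfderiv (𝓡 (2 * n)) f x (Ω.hamiltonianVectorField g x) = Ω.poissonBracket f g x :=
  (Ω.toFun_hamiltonianVectorField f x _).symm

lemma mvfderiv_hamiltonianVectorField_left (f g : C^∞⟮𝓡 (2 * n), M; ℝ⟯) (x : M) :
    mvfderiv (𝓡 (2 * n)) g x (Ω.hamiltonianVectorField f x) = -Ω.poissonBracket f g x := by
  rw [← toFun_hamiltonianVectorField, Ω.toFun_swap]
  rfl

variable [T2Space M]

/-- Invariant closedness is evaluated on global extensions of three coordinate fields; their
brackets vanish at the point and only the derivatives of the coefficients survive. -/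
lemma fderiv_formInChart_cyclic {p : M} {z : 𝔼} (hz : z ∈ (chartAt 𝔼 p).target) (a b c : 𝔼) :
    fderiv ℝ (Ω.formInChart p) z a b c + fderiv ℝ (Ω.formInChart p) z b c a +
      fderiv ℝ (Ω.formInChart p) z c a b = 0 := by
  set x := (chartAt 𝔼 p).symm z with hx
  have hxs : x ∈ (chartAt 𝔼 p).source := (chartAt 𝔼 p).map_target hz
  have hcont : Tendsto (chartAt 𝔼 p).symm (𝓝 z) (𝓝 x) :=
    (chartAt 𝔼 p).continuousAt_symm hz
  have hd := ((Ω.contDiffOn_formInChart p).contDiffAt (chartAt_mem_nhds_target hz)).differentiableAt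
    (by simp)
  have key : ∀ v : 𝔼, ∃ V : SmoothVectorField n M,
      ∀ᶠ y in 𝓝 z, V ((chartAt 𝔼 p).symm y) =
        mfderiv (𝓡 (2 * n)) (𝓡 (2 * n)) (chartAt 𝔼 p).symm y v := by
    intro v
    obtain ⟨V, hV, h⟩ := exists_contMDiff_eventuallyEq_coordinateField hxs v
    refine ⟨⟨V, hV⟩, ?_⟩
    filter_upwards [hcont.eventually h, chartAt_mem_nhds_target hz] with y hy hyt
    rw [← coordinateField_symm v hyt]
    exact hy
  -- Near `z` both fields have constant coefficients, so the derivatives in the coordinate bracket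
  -- are zero.
  have hlie : ∀ (V W : SmoothVectorField n M) (v w : 𝔼),
      (∀ᶠ y in 𝓝 z, V ((chartAt 𝔼 p).symm y) =
        mfderiv (𝓡 (2 * n)) (𝓡 (2 * n)) (chartAt 𝔼 p).symm y v) →
      (∀ᶠ y in 𝓝 z, W ((chartAt 𝔼 p).symm y) =
        mfderiv (𝓡 (2 * n)) (𝓡 (2 * n)) (chartAt 𝔼 p).symm y w) →
      mlieBracket (𝓡 (2 * n)) V W x = 0 := by
    intro V W v w hV hW
    have hV' : fieldInChart p V =ᶠ[𝓝 z] fun _ ↦ v := by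
      filter_upwards [hV, chartAt_mem_nhds_target hz] with y hy hyt
      exact fieldInChart_eq_of_eq V hyt hy
    have hW' : fieldInChart p W =ᶠ[𝓝 z] fun _ ↦ w := by
      filter_upwards [hW, chartAt_mem_nhds_target hz] with y hy hyt
      exact fieldInChart_eq_of_eq W hyt hy
    rw [hx, mlieBracket_chartAt_symm V.contMDiff W.contMDiff hz, lieBracket, hV'.fderiv_eq,
      hW'.fderiv_eq]
    simp only [fderiv_fun_const, Pi.zero_apply, zero_apply, sub_zero]
    exact map_zero _
  have hder : ∀ (U V W : SmoothVectorField n M) (u v w : 𝔼),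
      (∀ᶠ y in 𝓝 z, U ((chartAt 𝔼 p).symm y) =
        mfderiv (𝓡 (2 * n)) (𝓡 (2 * n)) (chartAt 𝔼 p).symm y u) →
      (∀ᶠ y in 𝓝 z, V ((chartAt 𝔼 p).symm y) =
        mfderiv (𝓡 (2 * n)) (𝓡 (2 * n)) (chartAt 𝔼 p).symm y v) →
      (∀ᶠ y in 𝓝 z, W ((chartAt 𝔼 p).symm y) =
        mfderiv (𝓡 (2 * n)) (𝓡 (2 * n)) (chartAt 𝔼 p).symm y w) →
      mvfderiv (𝓡 (2 * n)) (fun y ↦ Ω.toFun y (V y) (W y)) x (U x) =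
        fderiv ℝ (Ω.formInChart p) z u v w := by
    intro U V W u v w hU hV hW
    have hUx : U x = _ := hU.self_of_nhds
    rw [hUx, ← fderiv_comp_chartAt_symm hz
      ((Ω.contMDiff_toFun_apply V.contMDiff W.contMDiff).mdifferentiable (by simp) _)]
    have : (fun y ↦ Ω.toFun y (V y) (W y)) ∘ (chartAt 𝔼 p).symm =ᶠ[𝓝 z]
        fun y ↦ Ω.formInChart p y v w := by
      filter_upwards [hV, hW] with y hy1 hy2
      rw [Function.comp_apply, hy1, hy2]
      rfl
    rw [this.fderiv_eq]
    have h1 := (hd.hasFDerivAt.clm_apply (hasFDerivAt_const v z)).clm_apply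
      (hasFDerivAt_const w z)
    rw [h1.fderiv]
    simp
  obtain ⟨A, hA⟩ := key a
  obtain ⟨B, hB⟩ := key b
  obtain ⟨C, hC⟩ := key c
  have h := Ω.closed A B C x
  rw [extDerivTwoForm, hlie A B a b hA hB, hlie B C b c hB hC, hlie C A c a hC hA,
    hder A B C a b c hA hB hC, hder B C A b c a hB hC hA, hder C A B c a b hC hA hB] at h
  simpa using h

omit [T2Space M] in
-- In `dΩ(X_f, X_g, Z) = 0` every term except `Ω([X_f, X_g], Z)` is a derivative of `f`, `g` or
-- `{f,g}`. Writing `[X_g, Z]f` and `[Z, X_f]g` as commutators cancels the second derivatives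
-- `X_f(Zg)` and `X_g(Zf)`, and of the three terms `±Z{f,g}` one negative one remains.
lemma toFun_mlieBracket_hamiltonian (f g : C^∞⟮𝓡 (2 * n), M; ℝ⟯) (Z : SmoothVectorField n M)
    (x : M) :
    Ω.toFun x (mlieBracket (𝓡 (2 * n)) (Ω.hamiltonianVectorField f)
      (Ω.hamiltonianVectorField g) x) (Z x) =
      -mvfderiv (𝓡 (2 * n)) (Ω.poissonBracket f g) x (Z x) := by
  have h := Ω.closed (Ω.hamiltonianVectorField f) (Ω.hamiltonianVectorField g) Z x
  have h1 := mvfderiv_mlieBracket f.contMDiff (Ω.hamiltonianVectorField g).contMDiff Z.contMDiff x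
  have h2 := mvfderiv_mlieBracket g.contMDiff Z.contMDiff (Ω.hamiltonianVectorField f).contMDiff x
  simp only [extDerivTwoForm, toFun_hamiltonianVectorField,
    toFun_apply_hamiltonianVectorField, mvfderiv_hamiltonianVectorField_right] at h
  have hs : ∀ y, -Ω.poissonBracket g f y = Ω.poissonBracket f g y := fun y ↦
    (Ω.toFun_swap y _ _).symm
  simp only [hs] at h
  simp only [mvfderiv_hamiltonianVectorField_right] at h1
  simp only [mvfderiv_hamiltonianVectorField_left] at h2
  have e1 := congrArg (fun l ↦ l (Ω.hamiltonianVectorField g x)) (mvfderiv_neg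
    (I := 𝓡 (2 * n)) (g := fun y ↦ mvfderiv (𝓡 (2 * n)) f y (Z y)) (x := x))
  have e2 := congrArg (fun l ↦ l (Z x)) (mvfderiv_neg (I := 𝓡 (2 * n))
    (g := fun y ↦ Ω.poissonBracket f g y) (x := x))
  simp only [neg_apply] at e1 e2
  change mvfderiv (𝓡 (2 * n)) (fun y ↦ -mvfderiv (𝓡 (2 * n)) f y (Z y)) x _ = _ at e1
  change mvfderiv (𝓡 (2 * n)) (fun y ↦ -Ω.poissonBracket f g y) x _ = _ at e2
  rw [e2] at h2
  rw [e1] at h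
  linarith

lemma exists_smoothVectorField_apply_eq (x : M) (w : TangentSpace (𝓡 (2 * n)) x) :
    ∃ Z : SmoothVectorField n M, Z x = w := by
  have hx := mem_chart_source 𝔼 x
  obtain ⟨Z, hZ, h⟩ := exists_contMDiff_eventuallyEq_coordinateField hx
    (mfderiv (𝓡 (2 * n)) (𝓡 (2 * n)) (chartAt 𝔼 x) x w)
  refine ⟨⟨Z, hZ⟩, h.self_of_nhds.trans ?_⟩
  exact (isInvertible_mfderiv_chartAt hx).inverse_apply_self w

/-- The Lie bracket of Hamiltonian fields: `[X_f, X_g] = -X_{f, g}`. -/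
lemma mlieBracket_hamiltonianVectorField (f g : C^∞⟮𝓡 (2 * n), M; ℝ⟯) (x : M) :
    mlieBracket (𝓡 (2 * n)) (Ω.hamiltonianVectorField f) (Ω.hamiltonianVectorField g) x =
      -Ω.hamiltonianVectorField (Ω.poissonBracket f g) x := by
  refine eq_neg_of_add_eq_zero_left (Ω.nondegenerate x _ fun w ↦ ?_)
  obtain ⟨Z, rfl⟩ := exists_smoothVectorField_apply_eq x w
  rw [map_add, add_apply, toFun_mlieBracket_hamiltonian, toFun_hamiltonianVectorField,
    neg_add_cancel]

end SymplecticForm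

end SymplecticCharts
end


/-! ### Local frames, the complex Leibniz rule and the curvature identity. -/

noncomputable section

section Prequantum

set_option linter.unusedSectionVars false

open Set Filter Topology VectorField

variable {n : ℕ} {M : Type*} [TopologicalSpace M]
  [ChartedSpace (EuclideanSpace ℝ (Fin (2 * n))) M] [IsManifold (𝓡 (2 * n)) ∞ M]
  {L : M → Type*} [TopologicalSpace (Bundle.TotalSpace ℂ L)]
  [∀ x, AddCommGroup (L x)] [∀ x, Module ℂ (L x)] [∀ x, TopologicalSpace (L x)]
  [∀ x, IsTopologicalAddGroup (L x)] [∀ x, ContinuousSMul ℝ (L x)]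
  [FiberBundle ℂ L] [VectorBundle ℂ ℂ L] [VectorBundle ℝ ℂ L]
  [ContMDiffVectorBundle ∞ ℂ L (𝓡 (2 * n))]

local notation "𝔼" => EuclideanSpace ℝ (Fin (2 * n))

omit [IsManifold (𝓡 (2 * n)) ∞ M] in
lemma contMDiff_mul_complex {G A : M → ℂ} (hG : ContMDiff (𝓡 (2 * n)) 𝓘(ℝ, ℂ) ∞ G)
    (hA : ContMDiff (𝓡 (2 * n)) 𝓘(ℝ, ℂ) ∞ A) :
    ContMDiff (𝓡 (2 * n)) 𝓘(ℝ, ℂ) ∞ (fun y ↦ G y * A y) :=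
  (contDiff_mul (𝕜 := ℝ) (𝔸 := ℂ)).contMDiff.comp (hG.prodMk_space hA)

omit [IsManifold (𝓡 (2 * n)) ∞ M] in
lemma mvfderiv_mul_apply {G A : M → ℂ} (hG : ContMDiff (𝓡 (2 * n)) 𝓘(ℝ, ℂ) ∞ G)
    (hA : ContMDiff (𝓡 (2 * n)) 𝓘(ℝ, ℂ) ∞ A) (x : M) (v : TangentSpace (𝓡 (2 * n)) x) :
    mvfderiv (𝓡 (2 * n)) (fun y ↦ G y * A y) x v =
      G x * mvfderiv (𝓡 (2 * n)) A x v + A x * mvfderiv (𝓡 (2 * n)) G x v := by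
  have h := ((hG.mdifferentiable (by simp) x).hasMFDerivAt.mul
    (hA.mdifferentiable (by simp) x).hasMFDerivAt).mfderiv
  exact congrArg (fun l : 𝔼 →L[ℝ] ℂ ↦ l v) h

omit [IsManifold (𝓡 (2 * n)) ∞ M] in
lemma mvfderiv_add_apply {G A : M → ℂ} (hG : ContMDiff (𝓡 (2 * n)) 𝓘(ℝ, ℂ) ∞ G)
    (hA : ContMDiff (𝓡 (2 * n)) 𝓘(ℝ, ℂ) ∞ A) (x : M) (v : TangentSpace (𝓡 (2 * n)) x) :
    mvfderiv (𝓡 (2 * n)) (fun y ↦ G y + A y) x v =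
      mvfderiv (𝓡 (2 * n)) G x v + mvfderiv (𝓡 (2 * n)) A x v :=
  congrArg (fun l : TangentSpace (𝓡 (2 * n)) x →L[ℝ] ℂ ↦ l v)
    (mvfderiv_add (hG.mdifferentiable (by simp) x) (hA.mdifferentiable (by simp) x))

omit [IsManifold (𝓡 (2 * n)) ∞ M] in
lemma mvfderiv_clm_comp_apply {F F' : Type*} [NormedAddCommGroup F] [NormedSpace ℝ F]
    [NormedAddCommGroup F'] [NormedSpace ℝ F'] (l : F →L[ℝ] F') {G : M → F}
    {x : M} (hG : MDifferentiableAt (𝓡 (2 * n)) 𝓘(ℝ, F) G x) (v : TangentSpace (𝓡 (2 * n)) x) :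
    mvfderiv (𝓡 (2 * n)) (fun y ↦ l (G y)) x v = l (mvfderiv (𝓡 (2 * n)) G x v) := by
  have h := (l.hasMFDerivAt.comp x hG.hasMFDerivAt).mfderiv
  exact congrArg (fun l : 𝔼 →L[ℝ] F' ↦ l v) h

lemma IsSmoothSection.mdifferentiableAt {s : ∀ x, L x} (hs : IsSmoothSection n s) (x : M) :
    MDifferentiableAt (𝓡 (2 * n)) ((𝓡 (2 * n)).prod 𝓘(ℝ, ℂ))
      (fun y ↦ Bundle.TotalSpace.mk' ℂ y (s y)) x :=
  ContMDiffAt.mdifferentiableAt (hs x) (by simp)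

lemma smul_eq_re_smul_add_im_smul (G : M → ℂ) (s : ∀ x, L x) :
    (fun y ↦ G y • s y) = (fun y ↦ (G y).re) • s + (fun y ↦ (G y).im) • (Complex.I • s) := by
  funext y
  change G y • s y = ((G y).re : ℂ) • s y + ((G y).im : ℂ) • (Complex.I • s y)
  rw [smul_smul, ← add_smul, Complex.re_add_im]

lemma IsSmoothSection.smul {s : ∀ x, L x} (hs : IsSmoothSection n s) {G : M → ℂ}
    (hG : ContMDiff (𝓡 (2 * n)) 𝓘(ℝ, ℂ) ∞ G) : IsSmoothSection n (fun y ↦ G y • s y) := by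
  rw [smul_eq_re_smul_add_im_smul]
  exact ContMDiff.add_section
    (ContMDiff.smul_section (Complex.reCLM.contMDiff.comp hG) hs)
    (ContMDiff.smul_section (Complex.imCLM.contMDiff.comp hG) (isSmoothSection_smul _ hs))

namespace PrequantumStructure

variable {ħ : ℝ} {Ω : SymplecticForm n M} (P : PrequantumStructure L ħ Ω)

/-- The Leibniz rule of `conn` concerns real functions; splitting `G` into real and imaginary parts
and using `conn_complex` for multiplication by `i` extends it to complex ones. -/
lemma conn_smul {s : ∀ x, L x} (hs : IsSmoothSection n s) {G : M → ℂ}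
    (hG : ContMDiff (𝓡 (2 * n)) 𝓘(ℝ, ℂ) ∞ G) (x : M) (v : TangentSpace (𝓡 (2 * n)) x) :
    P.conn (fun y ↦ G y • s y) x v =
      mvfderiv (𝓡 (2 * n)) G x v • s x + G x • P.conn s x v := by
  have hre : ContMDiff (𝓡 (2 * n)) 𝓘(ℝ, ℝ) ∞ (fun y ↦ (G y).re) :=
    Complex.reCLM.contMDiff.comp hG
  have him : ContMDiff (𝓡 (2 * n)) 𝓘(ℝ, ℝ) ∞ (fun y ↦ (G y).im) :=
    Complex.imCLM.contMDiff.comp hG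
  have hI := isSmoothSection_smul (n := n) Complex.I hs
  rw [smul_eq_re_smul_add_im_smul, P.conn.isCovariantDerivativeOnUniv.add
    (IsSmoothSection.mdifferentiableAt (ContMDiff.smul_section hre hs) x)
    (IsSmoothSection.mdifferentiableAt (ContMDiff.smul_section him hI) x),
    P.conn.isCovariantDerivativeOnUniv.leibniz (hs.mdifferentiableAt x)
      (hre.mdifferentiable (by simp) x),
    P.conn.isCovariantDerivativeOnUniv.leibniz (hI.mdifferentiableAt x)
      (him.mdifferentiable (by simp) x)]
  have e1 := mvfderiv_clm_comp_apply Complex.reCLM (hG.mdifferentiable (by simp) x) v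
  have e2 := mvfderiv_clm_comp_apply Complex.imCLM (hG.mdifferentiable (by simp) x) v
  have e3 := P.conn_complex Complex.I s x v (hs.mdifferentiableAt x)
  change (((G x).re : ℂ) • P.conn s x v +
      ((mvfderiv (𝓡 (2 * n)) (fun y ↦ Complex.reCLM (G y)) x v : ℝ) : ℂ) • s x) +
    (((G x).im : ℂ) • P.conn (Complex.I • s) x v +
      ((mvfderiv (𝓡 (2 * n)) (fun y ↦ Complex.imCLM (G y)) x v : ℝ) : ℂ) • (Complex.I • s x)) = _
  rw [e1, e2, e3, Complex.reCLM_apply, Complex.imCLM_apply]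
  conv_rhs => rw [← Complex.re_add_im (G x), ← Complex.re_add_im (mvfderiv (𝓡 (2 * n)) G x v)]
  module

lemma conn_congr {s t : ∀ x, L x} (hs : IsSmoothSection n s) (ht : IsSmoothSection n t) {x : M}
    (h : ∀ᶠ y in 𝓝 x, s y = t y) : P.conn s x = P.conn t x :=
  (P.conn.isCovariantDerivativeOn (s := Set.univ)).congr_of_eventuallyEq
    (hs.mdifferentiableAt x) (ht.mdifferentiableAt x) Filter.univ_mem h

lemma isSmoothSection_conn {s : ∀ x, L x} (hs : IsSmoothSection n s) (X : SmoothVectorField n M) :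
    IsSmoothSection n (fun x ↦ P.conn s x (X x)) := by
  have h := P.conn_smooth.contMDiff.contMDiff (σ := s) (ContMDiff.contMDiffOn (by exact hs))
  rw [contMDiffOn_univ] at h
  exact ContMDiff.clm_bundle_apply h X.contMDiff

variable (n) in
/-- Near every point there is a nonvanishing section that is a frame for all smooth sections. -/
lemma exists_frame [T2Space M] (x₀ : M) :
    ∃ (s : ∀ x, L x) (l : ∀ x, L x →L[ℝ] ℂ) (U : Set M), IsOpen U ∧ x₀ ∈ U ∧
      IsSmoothSection n s ∧ (∀ y ∈ U, ∀ w, w = l y w • s y) ∧ (∀ y ∈ U, l y (s y) = 1) ∧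
      ∀ ψ : ∀ x, L x, IsSmoothSection n ψ → ∃ G : M → ℂ, ContMDiff (𝓡 (2 * n)) 𝓘(ℝ, ℂ) ∞ G ∧
        ∀ y ∈ U, G y = l y (ψ y) := by
  set e := trivializationAt ℂ L x₀ with he
  have hx₀ : x₀ ∈ e.baseSet := FiberBundle.mem_baseSet_trivializationAt' x₀
  obtain ⟨χ, hχ, h1, hsupp⟩ := exists_contMDiff_eventuallyEq_one (E := 𝔼) x₀
    (e.open_baseSet.mem_nhds hx₀)
  obtain ⟨U, hU, hUo, hxU⟩ := eventually_nhds_iff.1 (h1.and (e.open_baseSet.mem_nhds hx₀))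
  have hs : ContMDiffOn (𝓡 (2 * n)) ((𝓡 (2 * n)).prod 𝓘(ℝ, ℂ)) ∞
      (fun x ↦ Bundle.TotalSpace.mk' ℂ x (e.symmL ℝ x 1)) e.baseSet := by
    rw [e.contMDiffOn_section_baseSet_iff]
    refine (contMDiffOn_const (c := (1 : ℂ))).congr fun y hy ↦ ?_
    have := e.continuousLinearMapAt_symmL (R := ℝ) hy 1
    rwa [e.continuousLinearMapAt_apply_of_mem ℝ hy] at this
  have hsU : ∀ y ∈ U, χ y • e.symmL ℝ y 1 = e.symmL ℝ y 1 := fun y hy ↦ by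
    rw [(hU y hy).1, Pi.one_apply, one_smul]
  refine ⟨fun y ↦ χ y • e.symmL ℝ y 1, fun y ↦ e.continuousLinearMapAt ℝ y, U, hUo, hxU,
    ContMDiffOn.smul_section_of_tsupport hχ.contMDiffOn e.open_baseSet hsupp hs, ?_, ?_, ?_⟩
  · intro y hy w
    have hyb := (hU y hy).2
    beta_reduce
    rw [hsU y hy, ← e.symmL_continuousLinearMapAt (R := ℝ) hyb
      (e.continuousLinearMapAt ℝ y w • e.symmL ℝ y 1)]
    conv_lhs => rw [← e.symmL_continuousLinearMapAt (R := ℝ) hyb w]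
    congr 1
    rw [e.continuousLinearMapAt_apply_of_mem ℝ hyb (e.continuousLinearMapAt ℝ y w • e.symmL ℝ y 1),
      (e.linear ℂ hyb).2, ← e.continuousLinearMapAt_apply_of_mem ℝ hyb,
      e.continuousLinearMapAt_symmL hyb, smul_eq_mul, mul_one]
  · intro y hy
    beta_reduce
    rw [hsU y hy]
    exact e.continuousLinearMapAt_symmL (hU y hy).2 1
  · intro ψ hψ
    -- The coordinate of `ψ` is smooth only over the base set of the trivialization; the cutoff
    -- makes it global and equals `1` on `U`.
    refine ⟨fun y ↦ χ y • (e ⟨y, ψ y⟩).2, contMDiff_of_tsupport fun y hy ↦ ?_, fun y hy ↦ ?_⟩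
    · have hyb : y ∈ e.baseSet := hsupp (tsupport_smul_subset_left _ _ hy)
      have := (e.contMDiffOn_section_baseSet_iff (s := ψ) (n := ∞) (IB := 𝓡 (2 * n)) (𝕜 := ℝ)).1
        (ContMDiff.contMDiffOn hψ)
      exact hχ.contMDiffAt.smul (this.contMDiffAt (e.open_baseSet.mem_nhds hyb))
    · beta_reduce
      rw [(hU y hy).1, Pi.one_apply, one_smul, e.continuousLinearMapAt_apply_of_mem ℝ (hU y hy).2]

/-- The curvature identity `∇_X ∇_Y ψ - ∇_Y ∇_X ψ - ∇_{[X, Y]} ψ = (i / ħ) Ω(X, Y) ψ`. -/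
lemma conn_commutator [T2Space M] {ψ : ∀ x, L x} (hψ : IsSmoothSection n ψ)
    (X Y : SmoothVectorField n M) (x : M) :
    P.conn (fun y ↦ P.conn ψ y (Y y)) x (X x) - P.conn (fun y ↦ P.conn ψ y (X y)) x (Y x) -
      P.conn ψ x (mlieBracket (𝓡 (2 * n)) X Y x) =
      (2 * Real.pi * Complex.I * ((Ω.toFun x (X x) (Y x) / (2 * Real.pi * ħ) : ℝ) : ℂ)) • ψ x := by
  obtain ⟨s, l, U, hUo, hxU, hs, hl, hl1, hG⟩ := exists_frame (L := L) n x
  have hpi : (2 * Real.pi * Complex.I : ℂ) ≠ 0 := Complex.two_pi_I_ne_zero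
  obtain ⟨G, hGs, hGU⟩ := hG ψ hψ
  -- On `U` the function `A Z` is the connection coefficient in `∇_Z s = A(Z) s`, that is `2πi
  -- α(Z)`.
  choose A hAs hAU using fun Z : SmoothVectorField n M ↦ hG _ (P.isSmoothSection_conn hs Z)
  have hψU : ∀ y ∈ U, ψ y = G y • s y := fun y hy ↦ by rw [hGU y hy]; exact hl y hy _
  have hsU : ∀ Z : SmoothVectorField n M, ∀ y ∈ U, P.conn s y (Z y) = A Z y • s y :=
    fun Z y hy ↦ by rw [hAU Z y hy]; exact hl y hy _
  have hnhds : ∀ y ∈ U, U ∈ 𝓝 y := fun y hy ↦ hUo.mem_nhds hy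
  have hderψ : ∀ y ∈ U, ∀ v, P.conn ψ y v =
      mvfderiv (𝓡 (2 * n)) G y v • s y + G y • P.conn s y v := fun y hy v ↦ by
    rw [P.conn_congr hψ (hs.smul hGs) (mem_of_superset (hnhds y hy) hψU), P.conn_smul hs hGs]
  -- The coefficient of `∇_Z ψ` in the frame, where `ψ = G s`.
  let H : SmoothVectorField n M → M → ℂ := fun Z y ↦
    mvfderiv (𝓡 (2 * n)) G y (Z y) + G y * A Z y
  have hdG : ∀ Z : SmoothVectorField n M, ContMDiff (𝓡 (2 * n)) 𝓘(ℝ, ℂ) ∞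
      (fun y ↦ mvfderiv (𝓡 (2 * n)) G y (Z y)) := fun Z ↦
    contMDiff_mvfderiv_apply hGs Z.contMDiff
  have hH : ∀ Z, ContMDiff (𝓡 (2 * n)) 𝓘(ℝ, ℂ) ∞ (H Z) := fun Z ↦
    (hdG Z).add (contMDiff_mul_complex hGs (hAs Z))
  have hHU : ∀ Z : SmoothVectorField n M, ∀ y ∈ U, P.conn ψ y (Z y) = H Z y • s y :=
    fun Z y hy ↦ by rw [hderψ y hy, hsU Z y hy, smul_smul, ← add_smul]
  have h2 : ∀ Z W : SmoothVectorField n M, P.conn (fun y ↦ P.conn ψ y (Z y)) x (W x) =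
      (mvfderiv (𝓡 (2 * n)) (H Z) x (W x) + H Z x * A W x) • s x := fun Z W ↦ by
    rw [P.conn_congr (P.isSmoothSection_conn hψ Z) (hs.smul (hH Z))
      (mem_of_superset (hnhds x hxU) (hHU Z)), P.conn_smul hs (hH Z), hsU W x hxU, smul_smul,
      ← add_smul]
  have h3 : ∀ Z W : SmoothVectorField n M, mvfderiv (𝓡 (2 * n)) (H Z) x (W x) =
      mvfderiv (𝓡 (2 * n)) (fun y ↦ mvfderiv (𝓡 (2 * n)) G y (Z y)) x (W x) +
        (G x * mvfderiv (𝓡 (2 * n)) (A Z) x (W x) +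
          A Z x * mvfderiv (𝓡 (2 * n)) G x (W x)) := fun Z W ↦ by
    rw [← mvfderiv_mul_apply hGs (hAs Z)]
    exact mvfderiv_add_apply (hdG Z) (contMDiff_mul_complex hGs (hAs Z)) x (W x)
  let α : ∀ y : M, TangentSpace (𝓡 (2 * n)) y →L[ℝ] ℂ := fun y ↦
    ((ContinuousLinearMap.mul ℝ ℂ (2 * Real.pi * Complex.I)⁻¹).comp (l y)).comp (P.conn s y)
  have hα : ∀ y v, α y v = (2 * Real.pi * Complex.I)⁻¹ * l y (P.conn s y v) := fun _ _ ↦ rfl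
  have hcurv := P.curvature U s α hUo (ContMDiff.contMDiffOn hs)
    (fun y hy h0 ↦ by simpa [h0] using hl1 y hy)
    (fun y hy v ↦ by rw [hα, mul_inv_cancel_left₀ hpi]; exact hl y hy _) X Y x hxU
  have h4 : ∀ Z W : SmoothVectorField n M, mvfderiv (𝓡 (2 * n)) (fun y ↦ α y (Z y)) x (W x) =
      (2 * Real.pi * Complex.I)⁻¹ * mvfderiv (𝓡 (2 * n)) (A Z) x (W x) := fun Z W ↦ by
    have e : (fun y ↦ α y (Z y)) =ᶠ[𝓝 x] fun y ↦
        ContinuousLinearMap.mul ℝ ℂ (2 * Real.pi * Complex.I)⁻¹ (A Z y) := by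
      filter_upwards [hnhds x hxU] with y hy
      rw [hα, hAU Z y hy]
      rfl
    have e' := mvfderiv_clm_comp_apply (ContinuousLinearMap.mul ℝ ℂ (2 * Real.pi * Complex.I)⁻¹)
      ((hAs Z).mdifferentiable (by simp) x) (W x)
    refine Eq.trans ?_ e'
    exact congrArg (fun l : 𝔼 →L[ℝ] ℂ ↦ l (W x)) e.mfderiv_eq
  beta_reduce at hcurv
  -- The bracket enters only through its value at `x`, so its connection coefficient is needed at
  -- this point alone.
  obtain ⟨b, hb, hlb⟩ : ∃ b, P.conn s x (mlieBracket (𝓡 (2 * n)) X Y x) = b • s x ∧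
      l x (P.conn s x (mlieBracket (𝓡 (2 * n)) X Y x)) = b := ⟨_, hl x hxU _, rfl⟩
  rw [hcurv, extDerivOneForm, h4, h4, hα, h2, h2, hderψ x hxU, hlb, hb,
    mvfderiv_mlieBracket hGs X.contMDiff Y.contMDiff, h3, h3, hψU x hxU, smul_smul, smul_smul,
    ← add_smul, ← sub_smul, ← sub_smul]
  -- With `[X, Y]G` written as a commutator, all derivatives of `G` cancel; left is `G` times `X(A
  -- Y) - Y(A X) - b`, which is `2πi dα(X, Y)`.
  congr 1
  simp only [H]
  field_simp
  ring

end PrequantumStructure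

end Prequantum
end


/-! ### Algebra of the prequantization operators. -/

noncomputable section

section PrequantumOperators

set_option linter.unusedSectionVars false

open Set Filter Topology VectorField

variable {n : ℕ} {M : Type*} [TopologicalSpace M]
  [ChartedSpace (EuclideanSpace ℝ (Fin (2 * n))) M] [IsManifold (𝓡 (2 * n)) ∞ M]
  {L : M → Type*} [TopologicalSpace (Bundle.TotalSpace ℂ L)]
  [∀ x, AddCommGroup (L x)] [∀ x, Module ℂ (L x)] [∀ x, TopologicalSpace (L x)]
  [∀ x, IsTopologicalAddGroup (L x)] [∀ x, ContinuousSMul ℝ (L x)]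
  [FiberBundle ℂ L] [VectorBundle ℂ ℂ L] [VectorBundle ℝ ℂ L]
  [ContMDiffVectorBundle ∞ ℂ L (𝓡 (2 * n))]

namespace SymplecticForm

variable (Ω : SymplecticForm n M)

lemma hamiltonianVectorField_add (f g : C^∞⟮𝓡 (2 * n), M; ℝ⟯) (x : M) :
    Ω.hamiltonianVectorField (f + g) x =
      Ω.hamiltonianVectorField f x + Ω.hamiltonianVectorField g x := by
  change (Ω.toFun x).inverse (mvfderiv (𝓡 (2 * n)) (f + g) x) = _
  have h : mvfderiv (𝓡 (2 * n)) (⇑f + ⇑g) x = _ :=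
    mvfderiv_add (f.contMDiff.mdifferentiable (by simp) x) (g.contMDiff.mdifferentiable (by simp) x)
  exact (congrArg (Ω.toFun x).inverse h).trans (map_add _ _ _)

lemma hamiltonianVectorField_smul (c : ℝ) (f : C^∞⟮𝓡 (2 * n), M; ℝ⟯) (x : M) :
    Ω.hamiltonianVectorField (c • f) x = c • Ω.hamiltonianVectorField f x := by
  have h : mvfderiv (𝓡 (2 * n)) (⇑(c • f)) x = c • mvfderiv (𝓡 (2 * n)) f x := by
    ext v
    exact mvfderiv_clm_comp_apply (c • ContinuousLinearMap.id ℝ ℝ)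
      (f.contMDiff.mdifferentiable (by simp) x) v
  exact (congrArg (Ω.toFun x).inverse h).trans (map_smul _ _ _)

lemma hamiltonianVectorField_one (x : M) : Ω.hamiltonianVectorField 1 x = 0 := by
  have h : mvfderiv (𝓡 (2 * n)) (⇑(1 : C^∞⟮𝓡 (2 * n), M; ℝ⟯)) x = 0 :=
    mvfderiv_const (I := 𝓡 (2 * n)) (1 : ℝ) (x := x)
  exact (congrArg (Ω.toFun x).inverse h).trans (map_zero _)

end SymplecticForm

namespace PrequantumStructure

variable {ħ : ℝ} {Ω : SymplecticForm n M} (P : PrequantumStructure L ħ Ω)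

lemma operator_apply (f : C^∞⟮𝓡 (2 * n), M; ℝ⟯) (ψ : compactSections n L) (x : M) :
    (P.operator f ψ).1 x = (-(Complex.I * ħ)) • P.conn ψ.1 x (Ω.hamiltonianVectorField f x)
      + (f x : ℂ) • ψ.1 x := rfl

lemma isLinearMap_operator : IsLinearMap ℝ P.operator where
  map_add f g := by
    ext ψ x
    change (P.operator (f + g) ψ).1 x = (P.operator f ψ).1 x + (P.operator g ψ).1 x
    rw [operator_apply, operator_apply, operator_apply, Ω.hamiltonianVectorField_add, map_add]
    change _ + ((f x + g x : ℝ) : ℂ) • _ = _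
    push_cast
    module
  map_smul c f := by
    ext ψ x
    change (P.operator (c • f) ψ).1 x = (c : ℂ) • (P.operator f ψ).1 x
    rw [operator_apply, operator_apply, Ω.hamiltonianVectorField_smul, map_smul]
    change (-(Complex.I * ħ)) • ((c : ℂ) • P.conn ψ.1 x (Ω.hamiltonianVectorField f x)) +
      ((c * f x : ℝ) : ℂ) • ψ.1 x = _
    push_cast
    module

lemma operator_one : P.operator 1 = 1 := by
  ext ψ x
  change (P.operator 1 ψ).1 x = ψ.1 x
  rw [operator_apply, Ω.hamiltonianVectorField_one, map_zero, smul_zero, zero_add]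
  change ((1 : ℝ) : ℂ) • _ = _
  rw [Complex.ofReal_one, one_smul]

lemma conn_operator (f : C^∞⟮𝓡 (2 * n), M; ℝ⟯) (ψ : compactSections n L) (x : M)
    (v : TangentSpace (𝓡 (2 * n)) x) :
    P.conn (P.operator f ψ).1 x v =
      (-(Complex.I * ħ)) • P.conn (fun y ↦ P.conn ψ.1 y (Ω.hamiltonianVectorField f y)) x v +
        (f x : ℂ) • P.conn ψ.1 x v + (mvfderiv (𝓡 (2 * n)) f x v : ℂ) • ψ.1 x := by
  have h1 := P.isSmoothSection_conn ψ.2.1 (Ω.hamiltonianVectorField f)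
  have hf : ContMDiff (𝓡 (2 * n)) 𝓘(ℝ, ℂ) ∞ (fun y ↦ (f y : ℂ)) :=
    Complex.ofRealCLM.contMDiff.comp f.contMDiff
  have e : (P.operator f ψ).1 =
      ((-(Complex.I * ħ)) • fun y ↦ P.conn ψ.1 y (Ω.hamiltonianVectorField f y)) +
        fun y ↦ (f y : ℂ) • ψ.1 y := rfl
  have hadd := P.conn.isCovariantDerivativeOnUniv.add (x := x)
    ((isSmoothSection_smul (-(Complex.I * ħ)) h1).mdifferentiableAt x)
    ((IsSmoothSection.smul ψ.2.1 hf).mdifferentiableAt x)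
  rw [e, hadd, add_apply, P.conn_complex _ _ _ _ (h1.mdifferentiableAt x), P.conn_smul ψ.2.1 hf]
  have h2 : mvfderiv (𝓡 (2 * n)) (fun y ↦ (f y : ℂ)) x v = (mvfderiv (𝓡 (2 * n)) f x v : ℂ) :=
    mvfderiv_clm_comp_apply Complex.ofRealCLM (f.contMDiff.mdifferentiable (by simp) x) v
  rw [h2]
  abel

/-- The second order part is `(-iħ)²` times the commutator of `∇_{X_f}` and `∇_{X_g}`, equal to
`-∇_{X_{f,g}} + (i/ħ){f,g}` by the curvature identity and the bracket formula. The mixed terms are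
`-iħ(X_f g - X_g f) = 2iħ{f,g}`. The sum is `ħ² ∇_{X_{f,g}} + iħ{f,g}`. -/
lemma lie_operator [T2Space M] (hħ : ħ ≠ 0) (f g : C^∞⟮𝓡 (2 * n), M; ℝ⟯) :
    ⁅P.operator f, P.operator g⁆ = (Complex.I * ħ) • P.operator (Ω.poissonBracket f g) := by
  ext ψ x
  change (P.operator f (P.operator g ψ)).1 x - (P.operator g (P.operator f ψ)).1 x =
    (Complex.I * ħ) • (P.operator (Ω.poissonBracket f g) ψ).1 x
  have h := P.conn_commutator ψ.2.1 (Ω.hamiltonianVectorField f) (Ω.hamiltonianVectorField g) x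
  have hK : (2 * Real.pi * Complex.I * ((Ω.toFun x (Ω.hamiltonianVectorField f x)
      (Ω.hamiltonianVectorField g x) / (2 * Real.pi * ħ) : ℝ) : ℂ)) =
      Complex.I / ħ * (Ω.poissonBracket f g x : ℂ) := by
    change 2 * Real.pi * Complex.I * ((Ω.poissonBracket f g x / (2 * Real.pi * ħ) : ℝ) : ℂ) = _
    have : (Real.pi : ℂ) ≠ 0 := by exact_mod_cast Real.pi_ne_zero
    have : (ħ : ℂ) ≠ 0 := by exact_mod_cast hħ
    push_cast
    field_simp
  have hbr := congrArg (P.conn ψ.1 x) (Ω.mlieBracket_hamiltonianVectorField f g x)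
  rw [hK, hbr, map_neg, sub_neg_eq_add] at h
  have h' := eq_sub_of_add_eq h
  have h'' := eq_add_of_sub_eq h'
  rw [operator_apply, operator_apply, operator_apply, conn_operator, conn_operator, operator_apply,
    operator_apply, Ω.mvfderiv_hamiltonianVectorField_left,
    Ω.mvfderiv_hamiltonianVectorField_right, h'']
  have hI : (ħ : ℂ) ≠ 0 := by exact_mod_cast hħ
  push_cast
  match_scalars
  · field_simp
    linear_combination (Complex.I * ħ * (Ω.poissonBracket f g x : ℂ)) * Complex.I_mul_I
  all_goals ring

end PrequantumStructure

end PrequantumOperators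
end


/-! ### Gluing measures over an open cover. -/

noncomputable section

section GluingMeasures

open MeasureTheory Set

/-- A family of measures carried by the members of an open cover which agree on overlaps is glued
to one measure by taking the supremum. -/
lemma iSup_measure_restrict_eq {X ι : Type*} [TopologicalSpace X] [LindelofSpace X]
    [MeasurableSpace X] [OpensMeasurableSpace X] {U : ι → Set X} (hU : ∀ i, IsOpen (U i))
    (hcov : ⋃ i, U i = univ) {μ : ι → Measure X} (h0 : ∀ i, μ i (U i)ᶜ = 0)
    (hμ : ∀ i j A, MeasurableSet A → A ⊆ U i ∩ U j → μ i A = μ j A) (i : ι) :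
    (⨆ j, μ j).restrict (U i) = μ i := by
  have hres : ∀ j A, μ j A = μ j (A ∩ U j) := fun j A ↦
    (measure_inter_conull (h0 j)).symm
  obtain ⟨r, hr, hrU⟩ := isLindelof_univ.elim_countable_subcover U hU hcov.ge
  rcases isEmpty_or_nonempty X with hX | ⟨⟨x⟩⟩
  · exact Subsingleton.elim _ _
  have hr0 : r.Nonempty := by
    obtain ⟨j, hj, -⟩ := mem_iUnion₂.1 (hrU (mem_univ x))
    exact ⟨j, hj⟩
  obtain ⟨e, rfl⟩ := hr.exists_eq_range hr0
  have hS : ∀ k, MeasurableSet (disjointed (U ∘ e) k) := fun k ↦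
    MeasurableSet.disjointed (fun j ↦ (hU (e j)).measurableSet) k
  have hSU : ⋃ k, disjointed (U ∘ e) k = univ := by
    rw [iUnion_disjointed, eq_univ_iff_forall]
    intro y
    obtain ⟨j, ⟨k, rfl⟩, hy⟩ := mem_iUnion₂.1 (hrU (mem_univ y))
    exact mem_iUnion.2 ⟨k, hy⟩
  have hsum : ∀ (m : Measure X) A, MeasurableSet A →
      m A = ∑' k, m (A ∩ disjointed (U ∘ e) k) := by
    intro m A hA
    rw [← measure_iUnion, ← inter_iUnion, hSU, inter_univ]
    · exact fun a b hab ↦ ((disjoint_disjointed (U ∘ e)) hab).mono inter_subset_right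
        inter_subset_right
    · exact fun k ↦ hA.inter (hS k)
  -- A supremum of measures is not computed setwise, so an explicit upper bound is built: a
  -- countable subcover is made disjoint and each piece carries its own measure. On subsets of `U i`
  -- this bound agrees with `μ i`.
  set ν := Measure.sum fun k ↦ (μ (e k)).restrict (disjointed (U ∘ e) k) with hν
  have hνA : ∀ A, MeasurableSet A → ν A = ∑' k, μ (e k) (A ∩ disjointed (U ∘ e) k) := by
    intro A hA
    rw [hν, Measure.sum_apply _ hA]
    exact tsum_congr fun k ↦ Measure.restrict_apply hA
  have hstep : ∀ j k A, MeasurableSet A → A ⊆ U j →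
      μ j (A ∩ disjointed (U ∘ e) k) = μ (e k) (A ∩ disjointed (U ∘ e) k) := fun j k A hA hAj ↦
    hμ _ _ _ (hA.inter (hS k)) fun y hy ↦ ⟨hAj hy.1, disjointed_subset (U ∘ e) k hy.2⟩
  have hle : ⨆ j, μ j ≤ ν := by
    refine iSup_le fun j ↦ Measure.le_iff.2 fun A hA ↦ ?_
    have hAj := hA.inter (hU j).measurableSet
    rw [hres, hsum _ _ hAj, hνA _ hA]
    refine ENNReal.tsum_le_tsum fun k ↦ ?_
    rw [hstep j k _ hAj inter_subset_right]
    exact measure_mono (inter_subset_inter_left _ inter_subset_left)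
  refine le_antisymm (Measure.le_iff.2 fun A hA ↦ ?_) (Measure.le_iff.2 fun A hA ↦ ?_)
  · have hAi := hA.inter (hU i).measurableSet
    rw [Measure.restrict_apply hA, hres i A, hsum (μ i) _ hAi]
    refine (hle _).trans_eq ?_
    rw [hνA _ hAi]
    exact tsum_congr fun k ↦ (hstep i k _ hAi inter_subset_right).symm
  · rw [Measure.restrict_apply hA, hres i A]
    exact le_iSup μ i _

end GluingMeasures
end


/-! ### The Liouville measure in charts. -/

noncomputable section

section LiouvilleMeasure

open MeasureTheory Set Filter Topology

set_option synthInstance.maxHeartbeats 200000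

variable {n : ℕ} {M : Type*} [TopologicalSpace M]
  [ChartedSpace (EuclideanSpace ℝ (Fin (2 * n))) M] [IsManifold (𝓡 (2 * n)) ∞ M]

local notation "𝔼" => EuclideanSpace ℝ (Fin (2 * n))

lemma hasFDerivAt_chartAt_comp_symm {p q : M} {z : 𝔼} (hz : z ∈ (chartAt 𝔼 p).target)
    (hq : (chartAt 𝔼 p).symm z ∈ (chartAt 𝔼 q).source) :
    HasFDerivAt (chartAt 𝔼 q ∘ (chartAt 𝔼 p).symm)
      (fderiv ℝ (chartAt 𝔼 q ∘ (chartAt 𝔼 p).symm) z) z ∧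
    fderiv ℝ (chartAt 𝔼 q ∘ (chartAt 𝔼 p).symm) z =
      (mfderiv (𝓡 (2 * n)) (𝓡 (2 * n)) (chartAt 𝔼 q) ((chartAt 𝔼 p).symm z)).comp
        (mfderiv (𝓡 (2 * n)) (𝓡 (2 * n)) (chartAt 𝔼 p).symm z) := by
  have h0 := ((mdifferentiable_chartAt q).mdifferentiableAt hq).hasMFDerivAt.comp z
    ((mdifferentiable_chartAt p).mdifferentiableAt_symm hz).hasMFDerivAt
  have h : HasFDerivAt (chartAt 𝔼 q ∘ (chartAt 𝔼 p).symm) (_ : 𝔼 →L[ℝ] 𝔼) z := h0.hasFDerivAt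
  exact ⟨h.differentiableAt.hasFDerivAt, h.fderiv⟩

namespace SymplecticForm

variable (Ω : SymplecticForm n M)

lemma formInChart_mfderiv_chartAt {q x : M} (hx : x ∈ (chartAt 𝔼 q).source)
    (v w : TangentSpace (𝓡 (2 * n)) x) :
    Ω.formInChart q (chartAt 𝔼 q x) (mfderiv (𝓡 (2 * n)) (𝓡 (2 * n)) (chartAt 𝔼 q) x v)
      (mfderiv (𝓡 (2 * n)) (𝓡 (2 * n)) (chartAt 𝔼 q) x w) = Ω.toFun x v w := by
  obtain ⟨z, hz, rfl⟩ : ∃ z ∈ (chartAt 𝔼 q).target, (chartAt 𝔼 q).symm z = x :=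
    ⟨chartAt 𝔼 q x, (chartAt 𝔼 q).map_source hx, (chartAt 𝔼 q).left_inv hx⟩
  have h := mfderiv_chartAt_symm_comp hz
  have h' : ∀ u : TangentSpace (𝓡 (2 * n)) ((chartAt 𝔼 q).symm z),
      mfderiv (𝓡 (2 * n)) (𝓡 (2 * n)) (chartAt 𝔼 q).symm z
        (mfderiv (𝓡 (2 * n)) (𝓡 (2 * n)) (chartAt 𝔼 q) ((chartAt 𝔼 q).symm z) u) = u := fun u ↦
    congrArg (fun l : TangentSpace (𝓡 (2 * n)) ((chartAt 𝔼 q).symm z) →L[ℝ]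
      TangentSpace (𝓡 (2 * n)) ((chartAt 𝔼 q).symm z) ↦ l u) h
  have e : chartAt 𝔼 q ((chartAt 𝔼 q).symm z) = z := (chartAt 𝔼 q).right_inv hz
  refine (congrArg (fun y : 𝔼 ↦ Ω.formInChart q y
    (mfderiv (𝓡 (2 * n)) (𝓡 (2 * n)) (chartAt 𝔼 q) ((chartAt 𝔼 q).symm z) v)
    (mfderiv (𝓡 (2 * n)) (𝓡 (2 * n)) (chartAt 𝔼 q) ((chartAt 𝔼 q).symm z) w)) e).trans ?_
  exact congrArg₂ (fun a b ↦ Ω.toFun ((chartAt 𝔼 q).symm z) a b) (h' v) (h' w)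

/-- The change of variables formula for the density of the Liouville measure. -/
lemma chartDensity_eq_abs_det_mul {p q : M} {z : 𝔼} (hz : z ∈ (chartAt 𝔼 p).target)
    (hq : (chartAt 𝔼 p).symm z ∈ (chartAt 𝔼 q).source) :
    Ω.chartDensity p z = |(fderiv ℝ (chartAt 𝔼 q ∘ (chartAt 𝔼 p).symm) z).det| *
      Ω.chartDensity q (chartAt 𝔼 q ((chartAt 𝔼 p).symm z)) := by
  have h : Ω.formInChart p z = (Ω.formInChart q (chartAt 𝔼 q ((chartAt 𝔼 p).symm z))).bilinearComp
      (fderiv ℝ (chartAt 𝔼 q ∘ (chartAt 𝔼 p).symm) z)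
      (fderiv ℝ (chartAt 𝔼 q ∘ (chartAt 𝔼 p).symm) z) := by
    ext v w
    rw [(hasFDerivAt_chartAt_comp_symm hz hq).2]
    exact (Ω.formInChart_mfderiv_chartAt hq _ _).symm
  rw [chartDensity_eq, chartDensity_eq, h, volumeOfForm_bilinearComp,
    volumeOfForm_comp_eq_det_mul _ (EuclideanSpace.basisFun (Fin (2 * n)) ℝ).toBasis, abs_mul]

lemma continuousOn_chartDensity (p : M) :
    ContinuousOn (Ω.chartDensity p) (chartAt 𝔼 p).target := by
  have h := (((contDiff_volumeOfForm (k := 0) fun i : Fin (2 * n) ↦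
    EuclideanSpace.single i (1 : ℝ)).continuous).comp_continuousOn
    (Ω.contDiffOn_formInChart p).continuousOn).abs
  exact h.congr fun z _ ↦ Ω.chartDensity_eq p z

variable [MeasurableSpace M] [BorelSpace M]

omit [IsManifold (𝓡 (2 * n)) ∞ M] in
lemma measurableSet_symm_preimage_inter (p : M) {A : Set M} (hA : MeasurableSet A) :
    MeasurableSet ((chartAt 𝔼 p).symm ⁻¹' A ∩ (chartAt 𝔼 p).target) := by
  have h := (chartAt 𝔼 p).open_target.measurableSet.subtype_image
    ((continuousOn_iff_continuous_domRestrict.1 (chartAt 𝔼 p).continuousOn_symm).measurable hA)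
  convert h using 1
  ext z
  simp [and_comm]

omit [IsManifold (𝓡 (2 * n)) ∞ M] in
lemma aemeasurable_symm (p : M) :
    AEMeasurable (chartAt 𝔼 p).symm (volume.restrict (chartAt 𝔼 p).target) :=
  (chartAt 𝔼 p).continuousOn_symm.aemeasurable (chartAt 𝔼 p).open_target.measurableSet

lemma chartMeasure_apply (p : M) {A : Set M} (hA : MeasurableSet A) :
    Ω.chartMeasure p A = ∫⁻ z in (chartAt 𝔼 p).symm ⁻¹' A ∩ (chartAt 𝔼 p).target,
      ENNReal.ofReal (Ω.chartDensity p z) := by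
  rw [chartMeasure, Measure.map_apply_of_aemeasurable
    ((aemeasurable_symm p).mono_ac (withDensity_absolutelyContinuous _ _)) hA,
    withDensity_apply', Measure.restrict_restrict' (chartAt 𝔼 p).open_target.measurableSet]

lemma chartMeasure_compl_source (p : M) : Ω.chartMeasure p (chartAt 𝔼 p).sourceᶜ = 0 := by
  rw [chartMeasure_apply _ _ (chartAt 𝔼 p).open_source.measurableSet.compl]
  have : (chartAt 𝔼 p).symm ⁻¹' (chartAt 𝔼 p).sourceᶜ ∩ (chartAt 𝔼 p).target = ∅ := by
    ext z
    simp only [mem_inter_iff, mem_preimage, mem_compl_iff, mem_empty_iff_false, iff_false, not_and]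
    exact fun h hz ↦ h ((chartAt 𝔼 p).map_target hz)
  rw [this, Measure.restrict_empty, lintegral_zero_measure]

/-- The transition map `τ` carries one coordinate image of `A` onto the other, and the Jacobian from
the change of variables is the factor relating the two densities. -/
lemma chartMeasure_congr (p q : M) {A : Set M} (hA : MeasurableSet A)
    (hApq : A ⊆ (chartAt 𝔼 p).source ∩ (chartAt 𝔼 q).source) :
    Ω.chartMeasure p A = Ω.chartMeasure q A := by
  set s := (chartAt 𝔼 p).symm ⁻¹' A ∩ (chartAt 𝔼 p).target with hs
  set τ := chartAt 𝔼 q ∘ (chartAt 𝔼 p).symm with hτ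
  have himg : (chartAt 𝔼 q).symm ⁻¹' A ∩ (chartAt 𝔼 q).target = τ '' s := by
    ext y
    constructor
    · rintro ⟨hy, hyt⟩
      refine ⟨chartAt 𝔼 p ((chartAt 𝔼 q).symm y), ⟨?_, (chartAt 𝔼 p).map_source (hApq hy).1⟩, ?_⟩
      · rw [mem_preimage, (chartAt 𝔼 p).left_inv (hApq hy).1]
        exact hy
      · rw [hτ, Function.comp_apply, (chartAt 𝔼 p).left_inv (hApq hy).1,
          (chartAt 𝔼 q).right_inv hyt]
    · rintro ⟨z, ⟨hz, hzt⟩, rfl⟩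
      refine ⟨?_, (chartAt 𝔼 q).map_source (hApq hz).2⟩
      rw [mem_preimage, hτ, Function.comp_apply, (chartAt 𝔼 q).left_inv (hApq hz).2]
      exact hz
  have hinj : InjOn τ s := by
    intro z hz y hy h
    exact (chartAt 𝔼 p).symm.injOn hz.2 hy.2
      ((chartAt 𝔼 q).injOn (hApq hz.1).2 (hApq hy.1).2 h)
  have hder : ∀ z ∈ s, HasFDerivWithinAt τ (fderiv ℝ τ z) s z := fun z hz ↦
    (hasFDerivAt_chartAt_comp_symm hz.2 (hApq hz.1).2).1.hasFDerivWithinAt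
  rw [chartMeasure_apply _ _ hA, chartMeasure_apply _ _ hA, himg,
    lintegral_image_eq_lintegral_abs_det_fderiv_mul volume
      (measurableSet_symm_preimage_inter p hA) hder hinj]
  refine setLIntegral_congr_fun (measurableSet_symm_preimage_inter p hA) fun z hz ↦ ?_
  beta_reduce
  rw [Ω.chartDensity_eq_abs_det_mul hz.2 (hApq hz.1).2, ENNReal.ofReal_mul (abs_nonneg _)]
  rfl

/-- The Liouville measure restricts to the coordinate measure of each chart domain. -/
lemma liouvilleMeasure_restrict_source [SigmaCompactSpace M] (p : M) :
    Ω.liouvilleMeasure.restrict (chartAt 𝔼 p).source = Ω.chartMeasure p :=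
  iSup_measure_restrict_eq (fun q : M ↦ (chartAt 𝔼 q).open_source)
    (eq_univ_of_forall fun x ↦ mem_iUnion.2 ⟨x, mem_chart_source 𝔼 x⟩)
    Ω.chartMeasure_compl_source (fun p q _ hA h ↦ Ω.chartMeasure_congr p q hA h) p

lemma integral_liouvilleMeasure_eq [SigmaCompactSpace M] {F : Type*} [NormedAddCommGroup F]
    [NormedSpace ℝ F] [SecondCountableTopology F] (p : M) {g : M → F} (hg : Continuous g)
    (h0 : ∀ x ∉ (chartAt 𝔼 p).source, g x = 0) :
    ∫ x, g x ∂Ω.liouvilleMeasure =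
      ∫ z in (chartAt 𝔼 p).target, Ω.chartDensity p z • g ((chartAt 𝔼 p).symm z) := by
  borelize F
  have hd : AEMeasurable (fun z ↦ ENNReal.ofReal (Ω.chartDensity p z))
      (volume.restrict (chartAt 𝔼 p).target) :=
    ((Ω.continuousOn_chartDensity p).aemeasurable
      (chartAt 𝔼 p).open_target.measurableSet).ennreal_ofReal
  rw [← setIntegral_eq_integral_of_forall_compl_eq_zero h0, liouvilleMeasure_restrict_source,
    chartMeasure, integral_map
      ((aemeasurable_symm p).mono_ac (withDensity_absolutelyContinuous _ _))
      hg.stronglyMeasurable.aestronglyMeasurable,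
    integral_withDensity_eq_integral_toReal_smul₀ hd (Eventually.of_forall fun _ ↦
      ENNReal.ofReal_lt_top)]
  refine integral_congr_ae (Eventually.of_forall fun z ↦ ?_)
  beta_reduce
  rw [ENNReal.toReal_ofReal (by rw [chartDensity]; exact abs_nonneg _)]

/-- The density is continuous, hence integrable on a compact neighbourhood `K` inside the chart
image; the part of the chart domain lying over the interior of `K` has finite measure. -/
lemma isLocallyFiniteMeasure_liouvilleMeasure [SigmaCompactSpace M] :
    IsLocallyFiniteMeasure Ω.liouvilleMeasure where
  finiteAtNhds x := by
    have hxT : chartAt 𝔼 x x ∈ (chartAt 𝔼 x).target := mem_chart_target 𝔼 x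
    obtain ⟨K, hK, hKT, hKc⟩ := local_compact_nhds (chartAt_mem_nhds_target hxT)
    have hx := mem_chart_source 𝔼 x
    set V := (chartAt 𝔼 x).source ∩ chartAt 𝔼 x ⁻¹' interior K with hV
    have hVo : IsOpen V := (chartAt 𝔼 x).isOpen_inter_preimage isOpen_interior
    refine ⟨V, hVo.mem_nhds ⟨hx, mem_interior_iff_mem_nhds.2 hK⟩, ?_⟩
    have e : Ω.liouvilleMeasure V = Ω.chartMeasure x V := by
      rw [← liouvilleMeasure_restrict_source, Measure.restrict_apply hVo.measurableSet,
        inter_eq_left.2 inter_subset_left]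
    rw [e, chartMeasure_apply _ _ hVo.measurableSet]
    have hsub : (chartAt 𝔼 x).symm ⁻¹' V ∩ (chartAt 𝔼 x).target ⊆ K := by
      rintro z ⟨hz, hzT⟩
      have := interior_subset hz.2
      rwa [(chartAt 𝔼 x).right_inv hzT] at this
    have hint : IntegrableOn (Ω.chartDensity x) K :=
      ((Ω.continuousOn_chartDensity x).mono hKT).integrableOn_compact hKc
    exact (lintegral_mono_set hsub).trans_lt hint.lintegral_lt_top

end SymplecticForm

end LiouvilleMeasure
end


/-! ### Invariance of the Liouville measure under Hamiltonian fields. -/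

noncomputable section

section HamiltonianIntegrals

open MeasureTheory Set Filter Topology

set_option synthInstance.maxHeartbeats 200000

variable {n : ℕ} {M : Type*} [TopologicalSpace M]
  [ChartedSpace (EuclideanSpace ℝ (Fin (2 * n))) M] [IsManifold (𝓡 (2 * n)) ∞ M]

local notation "𝔼" => EuclideanSpace ℝ (Fin (2 * n))

omit [IsManifold (𝓡 (2 * n)) ∞ M] in
lemma mvfderiv_eq_zero_of_notMem_tsupport {u : M → ℂ} {x : M} (hx : x ∉ tsupport u) :
    mvfderiv (𝓡 (2 * n)) u x = 0 := by
  have h : u =ᶠ[𝓝 x] fun _ ↦ (0 : ℂ) := notMem_tsupport_iff_eventuallyEq.1 hx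
  exact (h.mfderiv_eq (I := 𝓡 (2 * n)) (I' := 𝓘(ℝ, ℂ))).trans mfderiv_const

/-- A smooth function supported in a chart domain is smooth in the coordinates of the chart, after
extension by zero. -/
lemma contDiff_indicator_comp_chartAt_symm [T2Space M] {p : M} {u : M → ℂ}
    (hu : ContMDiff (𝓡 (2 * n)) 𝓘(ℝ, ℂ) ∞ u) (hc : HasCompactSupport u)
    (hp : tsupport u ⊆ (chartAt 𝔼 p).source) :
    ContDiff ℝ ∞ ((chartAt 𝔼 p).target.indicator (u ∘ (chartAt 𝔼 p).symm)) ∧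
    HasCompactSupport ((chartAt 𝔼 p).target.indicator (u ∘ (chartAt 𝔼 p).symm)) ∧
    tsupport ((chartAt 𝔼 p).target.indicator (u ∘ (chartAt 𝔼 p).symm)) ⊆
      (chartAt 𝔼 p).target := by
  set w := (chartAt 𝔼 p).target.indicator (u ∘ (chartAt 𝔼 p).symm)
  have hK : IsCompact (chartAt 𝔼 p '' tsupport u) :=
    IsCompact.image_of_continuousOn hc ((chartAt 𝔼 p).continuousOn.mono hp)
  have hKT : chartAt 𝔼 p '' tsupport u ⊆ (chartAt 𝔼 p).target := by
    rintro _ ⟨x, hx, rfl⟩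
    exact (chartAt 𝔼 p).map_source (hp hx)
  have h0 : ∀ z ∉ chartAt 𝔼 p '' tsupport u, w z = 0 := by
    intro z hz
    by_contra h
    have hzT : z ∈ (chartAt 𝔼 p).target := by
      by_contra hzT
      exact h (indicator_of_notMem hzT _)
    refine hz ⟨(chartAt 𝔼 p).symm z, subset_tsupport u ?_, (chartAt 𝔼 p).right_inv hzT⟩
    rwa [show w z = u ((chartAt 𝔼 p).symm z) from indicator_of_mem hzT _] at h
  refine ⟨contDiff_iff_contDiffAt.2 fun z ↦ ?_, HasCompactSupport.intro hK h0,
    (closure_minimal (Function.support_subset_iff'.2 h0) hK.isClosed).trans hKT⟩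
  by_cases hz : z ∈ chartAt 𝔼 p '' tsupport u
  · have hzT := (chartAt 𝔼 p).open_target.mem_nhds (hKT hz)
    exact ((contDiffOn_comp_chartAt_symm hu).contDiffAt hzT).congr_of_eventuallyEq
      (eventuallyEq_of_mem hzT fun y hy ↦ indicator_of_mem hy _)
  · exact contDiffAt_const.congr_of_eventuallyEq
      (eventuallyEq_of_mem (hK.isClosed.isOpen_compl.mem_nhds hz) h0)

namespace SymplecticForm

variable (Ω : SymplecticForm n M) [MeasurableSpace M] [BorelSpace M] [T2Space M]
  [SigmaCompactSpace M]

/-- In coordinates this is the weighted divergence theorem `integral_abs_smul_fderiv_eq_zero`, whose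
hypothesis on the density is supplied by closedness of `Ω` and `Ω(X_f, ·) = df`. -/
lemma integral_mvfderiv_hamiltonian_of_tsupport_subset {p : M} {u : M → ℂ}
    (hu : ContMDiff (𝓡 (2 * n)) 𝓘(ℝ, ℂ) ∞ u) (hc : HasCompactSupport u)
    (hp : tsupport u ⊆ (chartAt 𝔼 p).source) (f : C^∞⟮𝓡 (2 * n), M; ℝ⟯) :
    ∫ x, mvfderiv (𝓡 (2 * n)) u x (Ω.hamiltonianVectorField f x) ∂Ω.liouvilleMeasure = 0 := by
  obtain ⟨hw, hwc, hwT⟩ := contDiff_indicator_comp_chartAt_symm hu hc hp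
  set w := (chartAt 𝔼 p).target.indicator (u ∘ (chartAt 𝔼 p).symm) with hwdef
  have hTo := (chartAt 𝔼 p).open_target
  have hX := contDiffOn_fieldInChart p (Ω.hamiltonianVectorField f).contMDiff
  have hA := Ω.contDiffOn_formInChart p
  have hf : ContDiffOn ℝ ∞ (f ∘ (chartAt 𝔼 p).symm) (chartAt 𝔼 p).target :=
    contDiffOn_comp_chartAt_symm f.contMDiff
  have hP : ContDiffOn ℝ 1 (fun z ↦ volumeOfForm (Ω.formInChart p z)
      fun i : Fin (2 * n) ↦ EuclideanSpace.single i (1 : ℝ)) (chartAt 𝔼 p).target :=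
    (contDiff_volumeOfForm _).comp_contDiffOn (hA.of_le (by simp))
  have key := integral_abs_smul_fderiv_eq_zero volume hTo (hw.of_le (by simp)) hwc hwT
    (hX.of_le (by simp)) hP fun z hz ↦ by
      have hzn := hTo.mem_nhds hz
      refine fderiv_volumeOfForm_hamiltonian (EuclideanSpace.basisFun (Fin (2 * n)) ℝ).toBasis _
        ((hA.contDiffAt hzn).differentiableAt (by simp))
        ((hX.contDiffAt hzn).differentiableAt (by simp))
        ((hf.contDiffAt hzn).of_le (WithTop.coe_le_coe.2 (le_top : (2 : ℕ∞) ≤ ⊤)))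
        (Eventually.of_forall fun y ↦ Ω.formInChart_swap p y)
        (Ω.fderiv_formInChart_cyclic hz) ?_
      filter_upwards [hzn] with y hy
      exact Ω.formInChart_fieldInChart p f hy
  have h0 : ∀ x ∉ (chartAt 𝔼 p).source,
      mvfderiv (𝓡 (2 * n)) u x (Ω.hamiltonianVectorField f x) = 0 := fun x hx ↦ by
    rw [mvfderiv_eq_zero_of_notMem_tsupport fun h ↦ hx (hp h)]
    rfl
  rw [Ω.integral_liouvilleMeasure_eq p
    (contMDiff_mvfderiv_apply hu (Ω.hamiltonianVectorField f).contMDiff).continuous h0, ← key]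
  refine Eq.trans ?_ (setIntegral_eq_integral_of_forall_compl_eq_zero
    (s := (chartAt 𝔼 p).target) ?_)
  · refine setIntegral_congr_fun hTo.measurableSet fun z hz ↦ ?_
    have e : w =ᶠ[𝓝 z] u ∘ (chartAt 𝔼 p).symm :=
      eventuallyEq_of_mem (hTo.mem_nhds hz) fun y hy ↦ indicator_of_mem hy _
    rw [← chartDensity_eq, e.fderiv_eq,
      fderiv_comp_chartAt_symm_fieldInChart hz (hu.mdifferentiable (by simp) _)]
  · intro z hz
    have : fderiv ℝ w z = 0 := by
      have h : w =ᶠ[𝓝 z] fun _ ↦ (0 : ℂ) :=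
        notMem_tsupport_iff_eventuallyEq.1 fun h ↦ hz (hwT h)
      rw [h.fderiv_eq, fderiv_fun_const]
      rfl
    rw [this, zero_apply, smul_zero]

omit [T2Space M] in
lemma integrable_liouvilleMeasure {g : M → ℂ} (hg : Continuous g) (hc : HasCompactSupport g) :
    Integrable g Ω.liouvilleMeasure := by
  have := Ω.isLocallyFiniteMeasure_liouvilleMeasure
  exact hg.integrable_of_hasCompactSupport hc

lemma integrable_mvfderiv_hamiltonian {u : M → ℂ} (hu : ContMDiff (𝓡 (2 * n)) 𝓘(ℝ, ℂ) ∞ u)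
    (hc : HasCompactSupport u) (f : C^∞⟮𝓡 (2 * n), M; ℝ⟯) :
    Integrable (fun x ↦ mvfderiv (𝓡 (2 * n)) u x (Ω.hamiltonianVectorField f x))
      Ω.liouvilleMeasure := by
  refine Ω.integrable_liouvilleMeasure
    (contMDiff_mvfderiv_apply hu (Ω.hamiltonianVectorField f).contMDiff).continuous
    (HasCompactSupport.intro hc fun x hx ↦ ?_)
  rw [mvfderiv_eq_zero_of_notMem_tsupport hx]
  rfl

/-- Hamiltonian vector fields preserve the Liouville measure. -/
lemma integral_mvfderiv_hamiltonian {u : M → ℂ} (hu : ContMDiff (𝓡 (2 * n)) 𝓘(ℝ, ℂ) ∞ u)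
    (hc : HasCompactSupport u) (f : C^∞⟮𝓡 (2 * n), M; ℝ⟯) :
    ∫ x, mvfderiv (𝓡 (2 * n)) u x (Ω.hamiltonianVectorField f x) ∂Ω.liouvilleMeasure = 0 := by
  obtain ⟨ρ, hρ⟩ := SmoothPartitionOfUnity.exists_isSubordinate_chartAt_source (𝓡 (2 * n)) M
  have hfin := ρ.locallyFinite.finite_nonempty_inter_compact hc
  -- Only finitely many members of the partition meet the compact support of `u`, so the
  -- decomposition of `u` is a finite sum and integration can be done termwise.
  have hsum : u = ∑ i ∈ hfin.toFinset, fun x ↦ (ρ i x : ℂ) * u x := by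
    ext x
    rw [Finset.sum_apply, ← Finset.sum_mul]
    by_cases hx : x ∈ tsupport u
    · have h1 := ρ.sum_eq_one (mem_univ x)
      rw [finsum_eq_sum_of_support_subset (s := hfin.toFinset) _ fun i hi ↦ by
        simpa using! ⟨x, hi, hx⟩] at h1
      rw [← Complex.ofReal_sum, h1, Complex.ofReal_one, one_mul]
    · rw [image_eq_zero_of_notMem_tsupport hx, mul_zero]
  rw [hsum]
  refine (Finset.sum_induction (p := fun v : M → ℂ ↦ ContMDiff (𝓡 (2 * n)) 𝓘(ℝ, ℂ) ∞ v ∧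
    HasCompactSupport v ∧ ∫ x, mvfderiv (𝓡 (2 * n)) v x (Ω.hamiltonianVectorField f x)
      ∂Ω.liouvilleMeasure = 0) _ ?_ ?_ ?_).2.2
  · rintro a b ⟨ha, hac, ha0⟩ ⟨hb, hbc, hb0⟩
    refine ⟨ha.add hb, hac.add hbc, ?_⟩
    have e : ∀ x, mvfderiv (𝓡 (2 * n)) (a + b) x (Ω.hamiltonianVectorField f x) =
        mvfderiv (𝓡 (2 * n)) a x (Ω.hamiltonianVectorField f x) +
          mvfderiv (𝓡 (2 * n)) b x (Ω.hamiltonianVectorField f x) := fun x ↦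
      mvfderiv_add_apply ha hb x _
    simp only [e]
    rw [integral_add (Ω.integrable_mvfderiv_hamiltonian ha hac f)
      (Ω.integrable_mvfderiv_hamiltonian hb hbc f), ha0, hb0, add_zero]
  · refine ⟨contMDiff_const, HasCompactSupport.zero, ?_⟩
    have e : ∀ x, mvfderiv (𝓡 (2 * n)) (0 : M → ℂ) x (Ω.hamiltonianVectorField f x) = 0 := by
      intro x
      rw [mvfderiv_eq_zero_of_notMem_tsupport (by simp)]
      rfl
    simp only [e, integral_zero]
  · intro i _
    have h1 : ContMDiff (𝓡 (2 * n)) 𝓘(ℝ, ℂ) ∞ (fun x ↦ (ρ i x : ℂ) * u x) :=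
      contMDiff_mul_complex (Complex.ofRealCLM.contMDiff.comp (ρ i).contMDiff) hu
    have h2 : HasCompactSupport (fun x ↦ (ρ i x : ℂ) * u x) := hc.mul_left
    refine ⟨h1, h2, Ω.integral_mvfderiv_hamiltonian_of_tsupport_subset (p := i) h1 h2 ?_ f⟩
    refine (closure_mono fun x hx ↦ ?_).trans (hρ i)
    rw [Function.mem_support] at hx ⊢
    exact fun h ↦ hx (by simp [h])

end SymplecticForm

end HamiltonianIntegrals

/-! ### Symmetry of the operators. -/

section SymmetricOperators

set_option linter.unusedSectionVars false

open MeasureTheory Set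

variable {n : ℕ} {M : Type*} [TopologicalSpace M] [T2Space M] [SigmaCompactSpace M]
  [ChartedSpace (EuclideanSpace ℝ (Fin (2 * n))) M] [IsManifold (𝓡 (2 * n)) ∞ M]
  [MeasurableSpace M] [BorelSpace M]
  {L : M → Type*} [TopologicalSpace (Bundle.TotalSpace ℂ L)]
  [∀ x, AddCommGroup (L x)] [∀ x, Module ℂ (L x)] [∀ x, TopologicalSpace (L x)]
  [∀ x, IsTopologicalAddGroup (L x)] [∀ x, ContinuousSMul ℝ (L x)]
  [FiberBundle ℂ L] [VectorBundle ℂ ℂ L] [VectorBundle ℝ ℂ L]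
  [ContMDiffVectorBundle ∞ ℂ L (𝓡 (2 * n))]

namespace PrequantumStructure

variable {ħ : ℝ} {Ω : SymplecticForm n M} (P : PrequantumStructure L ħ Ω)

lemma contMDiff_pairing (ψ φ : compactSections n L) :
    ContMDiff (𝓡 (2 * n)) 𝓘(ℝ, ℂ) ∞ (P.pairing ψ φ) :=
  P.herm.smooth _ _ ψ.2.1 φ.2.1

lemma hasCompactSupport_pairing (ψ φ : compactSections n L) :
    HasCompactSupport (P.pairing ψ φ) := by
  refine HasCompactSupport.intro ψ.2.2 fun x hx ↦ ?_
  have h : ψ.1 x = 0 := by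
    by_contra h
    exact hx (subset_closure h)
  rw [pairing, h, map_zero, LinearMap.zero_apply]

lemma integrable_pairing (ψ φ : compactSections n L) :
    Integrable (P.pairing ψ φ) Ω.liouvilleMeasure :=
  Ω.integrable_liouvilleMeasure (P.contMDiff_pairing ψ φ).continuous
    (P.hasCompactSupport_pairing ψ φ)

/-- As `f` is real, the terms with `f` agree on both sides. As `ħ` is real, conjugation turns `-iħ`
into `iħ`, so the two covariant derivatives combine into the derivative of `h(ψ, φ)`. -/
lemma pairing_operator (f : C^∞⟮𝓡 (2 * n), M; ℝ⟯) (ψ φ : compactSections n L) (x : M) :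
    P.pairing (P.operator f ψ) φ x = P.pairing ψ (P.operator f φ) x +
      -(Complex.I * ħ) *
        mvfderiv (𝓡 (2 * n)) (P.pairing ψ φ) x (Ω.hamiltonianVectorField f x) := by
  have h := P.compatible ψ.1 φ.1 ψ.2.1 φ.2.1 x (Ω.hamiltonianVectorField f x)
  change mvfderiv (𝓡 (2 * n)) (P.pairing ψ φ) x (Ω.hamiltonianVectorField f x) = _ at h
  rw [h, pairing, pairing, operator_apply, operator_apply]
  simp only [map_add, LinearMap.add_apply, map_smul, LinearMap.smul_apply, LinearMap.map_smulₛₗ,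
    smul_eq_mul, map_neg, map_mul, Complex.conj_I, Complex.conj_ofReal]
  ring

lemma innerProduct_operator (f : C^∞⟮𝓡 (2 * n), M; ℝ⟯) (ψ φ : compactSections n L) :
    P.innerProduct (P.operator f ψ) φ = P.innerProduct ψ (P.operator f φ) := by
  rw [innerProduct, innerProduct]
  congr 1
  simp only [pairing_operator]
  rw [integral_add (P.integrable_pairing _ _)
    ((Ω.integrable_mvfderiv_hamiltonian (P.contMDiff_pairing ψ φ)
      (P.hasCompactSupport_pairing ψ φ) f).const_mul _), integral_const_mul,
    Ω.integral_mvfderiv_hamiltonian (P.contMDiff_pairing ψ φ) (P.hasCompactSupport_pairing ψ φ),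
    mul_zero, add_zero]

end PrequantumStructure

end SymmetricOperators
end

theorem mainTheorem6 {n : ℕ} {M : Type*} [TopologicalSpace M] [T2Space M] [SigmaCompactSpace M]
    [ChartedSpace (EuclideanSpace ℝ (Fin (2 * n))) M] [IsManifold (𝓡 (2 * n)) ∞ M]
    [MeasurableSpace M] [BorelSpace M]
    {L : M → Type*} [TopologicalSpace (Bundle.TotalSpace ℂ L)]
    [∀ x, AddCommGroup (L x)] [∀ x, Module ℂ (L x)] [∀ x, TopologicalSpace (L x)]
    [∀ x, IsTopologicalAddGroup (L x)] [∀ x, ContinuousSMul ℝ (L x)]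
    [FiberBundle ℂ L] [VectorBundle ℂ ℂ L] [VectorBundle ℝ ℂ L]
    [ContMDiffVectorBundle ∞ ℂ L (𝓡 (2 * n))]
    (ħ : ℝ) (hħ : 0 < ħ) (Ω : SymplecticForm n M) (P : PrequantumStructure L ħ Ω) :
    IsLinearMap ℝ P.operator ∧
    (∀ ψ φ : compactSections n L,
      MeasureTheory.Integrable (P.pairing ψ φ) Ω.liouvilleMeasure) ∧
    (∀ (f : C^∞⟮𝓡 (2 * n), M; ℝ⟯) (ψ φ : compactSections n L),
      P.innerProduct (P.operator f ψ) φ = P.innerProduct ψ (P.operator f φ)) ∧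
    P.operator 1 = 1 ∧
    (∀ f g : C^∞⟮𝓡 (2 * n), M; ℝ⟯,
      ⁅P.operator f, P.operator g⁆ = (Complex.I * ħ) • P.operator (Ω.poissonBracket f g)) :=
  ⟨P.isLinearMap_operator, P.integrable_pairing, P.innerProduct_operator, P.operator_one,
    P.lie_operator hħ.ne'⟩
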